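/- Let $d\in\mathbb N$ and let $\mathbb S_d$ be the elliptic Scheffers algebra: the commutative associative unital real algebra of dimension $2^d$ generated by $e_1,\dots,e_d$ with $e_k^2=-1$ and $e_ke_l=e_le_k$, with basis $e_\beta=\prod_{k\in\beta}e_k$ ($\beta\subseteq\{1,\dots,d\}$) and the Euclidean norm $|w|=\big(\sum_\beta w_\beta^2\big)^{1/2}$. Let $\mathbb S(k)=\{a+be_k: a,b\in\mathbb R\}\subseteq\mathbb S_d$ (every nonzero element of which is invertible), $\mathbb S^d=\bigoplus_{k=1}^d\mathbb S(k)$, and $\mathbb S^d_+=\{(x_k+e_ky_k)_{k}\in\mathbb S^d: y_k>0 \text{ for all }k\}$. A function $f:\mathbb S^d_+\to\mathbb S_d$ is holomorphic if at every point of $\mathbb S^d_+$ and for every $k$ the limit, as $z\to z_k$ in $\mathbb S(k)$, of the difference quotient $\big(f(z_1,\dots,z,\dots,z_d)-f(z_1,\dots,z_k,\dots,z_d)\big)/(z-z_k)$ exists in $\mathbb S_d$. The Hardy space $H^2(\mathbb S^d_+,\mathbb S_d)$ consists of the holomorphic $f$ with $$\sup_{y_1,\dots,y_d>0}\int_{\mathbb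 R^d}|f(x_1+e_1y_1,\dots,x_d+e_dy_d)|^2\,dx<\infty .$$ $L^2(\mathbb R^d_+,\mathbb S_d)$ is the space of square integrable $g:\mathbb R^d\to\mathbb S_d$ that vanish almost everywhere outside $[0,\infty)^d$. For such $g$ and $\zeta\in\mathbb S^d_+$ the holomorphic inverse Fourier transform is $$F^{-1}[g](\zeta)=\frac1{(2\pi)^d}\int_{\mathbb R^d} g(\omega)\,e^{e_1\omega_1\zeta_1}\cdots e^{e_d\omega_d\zeta_d}\,d\omega .$$ The usual inverse Fourier transform of $g\in L^2(\mathbb R^d,\mathbb S_d)$ is the $L^2(\mathbb R^d,\mathbb S_d)$-limit, as $R\to\infty$, of $x\mapsto(2\pi)^{-d}\int_{[-R,R]^d}g(\omega)e^{e_1\omega_1x_1}\cdots e^{e_d\omega_dx_d}\,d\omega$. **Theorem (Paley–Wiener).** 1. Let $\hat f\in L^2(\mathbb R^d_+,\mathbb S_d)$. Then the integral defining $f(\zeta)=F^{-1}[\hat f](\zeta)$ converges absolutely for every $\zeta\in\mathbb S^d_+$, and $f\in H^2(\mathbb S^d_+,\mathbb S_d)$. Furthermore the usual inverse Fourier transform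 $f_0\in L^2(\mathbb R^d,\mathbb S_d)$ of $\hat f$ exists and is the boundary value of $f$ in the sense that $$\lim_{(y_1,\dots,y_d)\to(0^+,\dots,0^+)}\int_{\mathbb R^d}|f(x_1+e_1y_1,\dots,x_d+e_dy_d)-f_0(x_1,\dots,x_d)|^2\,dx=0 .$$ 2. Conversely, for every $f\in H^2(\mathbb S^d_+,\mathbb S_d)$ there is $g\in L^2(\mathbb R^d_+,\mathbb S_d)$ such that $f(\zeta)=F^{-1}[g](\zeta)$ for all $\zeta\in\mathbb S^d_+$, the integral converging absolutely. -/

import Mathlib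

open MeasureTheory Filter Topology
open scoped symmDiff ENNReal

noncomputable section

/-- The elliptic Scheffers algebra `𝕊_d`: real vectors indexed by the subsets `β` of `{1, …, d}`
(the coordinate at `β` is the coefficient of `e_β = ∏_{k ∈ β} e_k`), with the Euclidean norm. -/
def ScheffersAlgebra (d : ℕ) : Type := EuclideanSpace ℝ (Finset (Fin d))

namespace ScheffersAlgebra

variable {d : ℕ}

instance : NormedAddCommGroup (ScheffersAlgebra d) :=
  inferInstanceAs (NormedAddCommGroup (EuclideanSpace ℝ (Finset (Fin d))))

instance : NormedSpace ℝ (ScheffersAlgebra d) :=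
  inferInstanceAs (NormedSpace ℝ (EuclideanSpace ℝ (Finset (Fin d))))

instance : FiniteDimensional ℝ (ScheffersAlgebra d) :=
  inferInstanceAs (FiniteDimensional ℝ (EuclideanSpace ℝ (Finset (Fin d))))

/-- The coefficient of `e_β` in `w`. -/
def coeff (w : ScheffersAlgebra d) (β : Finset (Fin d)) : ℝ := WithLp.ofLp w β

/-- The element with given coefficients. -/
def ofCoeff (c : Finset (Fin d) → ℝ) : ScheffersAlgebra d := WithLp.toLp 2 c

@[simp] theorem coeff_ofCoeff (c : Finset (Fin d) → ℝ) (β : Finset (Fin d)) :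
    (ofCoeff c).coeff β = c β := rfl

@[ext] theorem ext_coeff {v w : ScheffersAlgebra d} (h : ∀ β, v.coeff β = w.coeff β) : v = w :=
  WithLp.ofLp_injective 2 (funext h)

@[simp] theorem coeff_add (v w : ScheffersAlgebra d) (β : Finset (Fin d)) :
    (v + w).coeff β = v.coeff β + w.coeff β := rfl

@[simp] theorem coeff_zero (β : Finset (Fin d)) : (0 : ScheffersAlgebra d).coeff β = 0 := rfl

@[simp] theorem coeff_smul (r : ℝ) (w : ScheffersAlgebra d) (β : Finset (Fin d)) :
    (r • w).coeff β = r * w.coeff β := rfl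

theorem continuous_coeff (β : Finset (Fin d)) :
    Continuous fun w : ScheffersAlgebra d => w.coeff β :=
  (continuous_apply β).comp (PiLp.continuous_ofLp 2 _)

/-- The norm is the Euclidean norm of the coefficients. -/
theorem norm_eq (w : ScheffersAlgebra d) : ‖w‖ = Real.sqrt (∑ β, |w.coeff β| ^ 2) :=
  EuclideanSpace.norm_eq (𝕜 := ℝ) (n := Finset (Fin d)) w

/-- The sign in `e_A e_B = (-1)^{|A ∩ B|} e_{A ∆ B}`. -/
def unitSign (A B : Finset (Fin d)) : ℝ := (-1) ^ (A ∩ B).card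

theorem unitSign_eq_prod (A B : Finset (Fin d)) :
    unitSign A B = ∏ k, if k ∈ A ∧ k ∈ B then (-1 : ℝ) else 1 := by
  rw [unitSign, Finset.prod_ite]
  rw [Finset.prod_const, Finset.prod_const_one, mul_one]
  congr 2
  ext k
  simp

theorem unitSign_comm (A B : Finset (Fin d)) : unitSign A B = unitSign B A := by
  rw [unitSign, unitSign, Finset.inter_comm]

theorem unitSign_assoc (A B C : Finset (Fin d)) :
    unitSign A B * unitSign (A ∆ B) C = unitSign B C * unitSign A (B ∆ C) := by
  simp only [unitSign_eq_prod, ← Finset.prod_mul_distrib]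
  refine Finset.prod_congr rfl fun k _ => ?_
  by_cases hA : k ∈ A <;> by_cases hB : k ∈ B <;> by_cases hC : k ∈ C <;>
    simp [Finset.mem_symmDiff, hA, hB, hC]

/-- Multiplication is the bilinear extension of `e_A e_B = (-1)^{|A ∩ B|} e_{A ∆ B}`;
the pairs `(A, B)` with `A ∆ B = C` are the pairs `(A, A ∆ C)`. -/
instance : Mul (ScheffersAlgebra d) :=
  ⟨fun v w => ofCoeff fun C => ∑ A, unitSign A (A ∆ C) * v.coeff A * w.coeff (A ∆ C)⟩

/-- The basis element `e_β`. -/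
def basisElt (β : Finset (Fin d)) : ScheffersAlgebra d := ofCoeff fun γ => if γ = β then 1 else 0

instance : One (ScheffersAlgebra d) := ⟨basisElt ∅⟩

theorem coeff_mul (v w : ScheffersAlgebra d) (C : Finset (Fin d)) :
    (v * w).coeff C = ∑ A, unitSign A (A ∆ C) * v.coeff A * w.coeff (A ∆ C) := rfl

theorem coeff_one (C : Finset (Fin d)) :
    (1 : ScheffersAlgebra d).coeff C = if C = ∅ then 1 else 0 := rfl

/-- The bijection `B ↦ A ∆ B` of the subsets. -/
def symmDiffEquiv (A : Finset (Fin d)) : Finset (Fin d) ≃ Finset (Fin d) where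
  toFun B := A ∆ B
  invFun B := A ∆ B
  left_inv B := symmDiff_symmDiff_cancel_left A B
  right_inv B := symmDiff_symmDiff_cancel_left A B

protected theorem mul_comm' (v w : ScheffersAlgebra d) : v * w = w * v := by
  ext C
  rw [coeff_mul, coeff_mul, ← (symmDiffEquiv C).sum_comp]
  refine Finset.sum_congr rfl fun A _ => ?_
  have h : (C ∆ A) ∆ C = A := by rw [symmDiff_comm, symmDiff_symmDiff_cancel_left]
  simp only [symmDiffEquiv, Equiv.coe_fn_mk, h]
  rw [unitSign_comm, symmDiff_comm C A]
  ring

protected theorem one_mul' (w : ScheffersAlgebra d) : 1 * w = w := by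
  ext C
  simp only [coeff_mul, coeff_one, mul_ite, mul_one, mul_zero, ite_mul, zero_mul]
  rw [Finset.sum_ite_eq' Finset.univ ∅]
  have h : (∅ : Finset (Fin d)) ∆ C = C := bot_symmDiff C
  simp [h, unitSign]

protected theorem mul_add' (u v w : ScheffersAlgebra d) : u * (v + w) = u * v + u * w := by
  ext C
  simp only [coeff_mul, coeff_add, mul_add, Finset.sum_add_distrib]

protected theorem mul_assoc' (u v w : ScheffersAlgebra d) : u * v * w = u * (v * w) := by
  ext D
  simp only [coeff_mul, Finset.mul_sum, Finset.sum_mul]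
  rw [Finset.sum_comm]
  refine Finset.sum_congr rfl fun A _ => ?_
  rw [← (symmDiffEquiv A).sum_comp]
  refine Finset.sum_congr rfl fun B _ => ?_
  simp only [symmDiffEquiv, Equiv.coe_fn_mk, symmDiff_symmDiff_cancel_left]
  have h1 : (A ∆ B) ∆ D = B ∆ (A ∆ D) := by
    rw [symmDiff_comm A B, symmDiff_assoc]
  have h2 : B ∆ (B ∆ (A ∆ D)) = A ∆ D := symmDiff_symmDiff_cancel_left _ _
  have h := unitSign_assoc A B (B ∆ (A ∆ D))
  rw [h2] at h
  rw [h1]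
  linear_combination (u.coeff A * v.coeff B * w.coeff (B ∆ (A ∆ D))) * h

instance : CommRing (ScheffersAlgebra d) where
  __ := (inferInstance : AddCommGroup (ScheffersAlgebra d))
  mul_assoc := ScheffersAlgebra.mul_assoc'
  mul_comm := ScheffersAlgebra.mul_comm'
  one_mul := ScheffersAlgebra.one_mul'
  mul_one w := by rw [ScheffersAlgebra.mul_comm', ScheffersAlgebra.one_mul']
  left_distrib := ScheffersAlgebra.mul_add'
  right_distrib u v w := by
    rw [ScheffersAlgebra.mul_comm', ScheffersAlgebra.mul_add', ScheffersAlgebra.mul_comm' w u,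
      ScheffersAlgebra.mul_comm' w v]
  zero_mul w := by ext C; simp [coeff_mul]
  mul_zero w := by ext C; simp [coeff_mul]

instance : Algebra ℝ (ScheffersAlgebra d) :=
  Algebra.ofModule
    (fun r v w => by
      ext C
      simp only [coeff_mul, coeff_smul, Finset.mul_sum]
      exact Finset.sum_congr rfl fun A _ => by ring)
    (fun r v w => by
      ext C
      simp only [coeff_mul, coeff_smul, Finset.mul_sum]
      exact Finset.sum_congr rfl fun A _ => by ring)

instance : IsTopologicalRing (ScheffersAlgebra d) where
  continuous_add := continuous_add
  continuous_neg := continuous_neg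
  continuous_mul := by
    refine (PiLp.continuous_toLp 2 (fun _ : Finset (Fin d) => ℝ)).comp
      (continuous_pi fun C => continuous_finsetSum _ fun A _ => ?_)
    exact (continuous_const.mul ((continuous_coeff A).comp continuous_fst)).mul
      ((continuous_coeff _).comp continuous_snd)

/-- The generator `e_k`. -/
def gen (k : Fin d) : ScheffersAlgebra d := basisElt {k}

theorem basisElt_mul (A B : Finset (Fin d)) :
    basisElt A * basisElt B = unitSign A B • basisElt (A ∆ B) := by
  ext C
  have h : A ∆ C = B ↔ C = A ∆ B :=
    ⟨fun h => by rw [← h, symmDiff_symmDiff_cancel_left],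
      fun h => by rw [h, symmDiff_symmDiff_cancel_left]⟩
  simp only [coeff_mul, coeff_smul, basisElt, coeff_ofCoeff, mul_ite, mul_one, mul_zero]
  rw [Finset.sum_eq_single A (fun A' _ hA => by simp [hA]) (by simp)]
  by_cases hC : C = A ∆ B
  · simp [hC, symmDiff_symmDiff_cancel_left]
  · simp [hC, h]

theorem gen_mul_gen_self (k : Fin d) : gen k * gen k = -1 := by
  rw [gen, basisElt_mul, symmDiff_self]
  have h : (basisElt (⊥ : Finset (Fin d))) = 1 := rfl
  rw [h]
  simp [unitSign]

/-- The plane `𝕊(k) = {a + b e_k : a, b ∈ ℝ}` inside `𝕊_d`. -/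
def plane (d : ℕ) (k : Fin d) : Submodule ℝ (ScheffersAlgebra d) := Submodule.span ℝ {1, gen k}

/-- The element `a + b e_k` of `𝕊(k)`. -/
def planeMk (k : Fin d) (a b : ℝ) : plane d k :=
  ⟨a • 1 + b • gen k, Submodule.mem_span_pair.2 ⟨a, b, rfl⟩⟩

/-- The nonzero elements of `𝕊(k)` are invertible in `𝕊_d`. -/
theorem isUnit_of_mem_plane {k : Fin d} {w : ScheffersAlgebra d} (hw : w ∈ plane d k)
    (h0 : w ≠ 0) : IsUnit w := by
  obtain ⟨a, b, rfl⟩ := Submodule.mem_span_pair.1 hw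
  have hab : a ^ 2 + b ^ 2 ≠ 0 := by
    intro h
    have ha : a = 0 := by nlinarith [sq_nonneg a, sq_nonneg b]
    have hb : b = 0 := by nlinarith [sq_nonneg a, sq_nonneg b]
    exact h0 (by simp [ha, hb])
  refine IsUnit.of_mul_eq_one ((a ^ 2 + b ^ 2)⁻¹ • (a • 1 - b • gen k)) ?_
  have h : (a • (1 : ScheffersAlgebra d) + b • gen k) * (a • 1 - b • gen k)
      = (a ^ 2 + b ^ 2) • 1 := by
    have := gen_mul_gen_self k
    simp only [Algebra.smul_def, map_add, map_pow, mul_one]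
    linear_combination (-(algebraMap ℝ (ScheffersAlgebra d) b) ^ 2) * this
  rw [mul_smul_comm, h, smul_smul, inv_mul_cancel₀ hab, one_smul]

/-- The total Scheffers space `𝕊^d = 𝕊(1) ⊕ ⋯ ⊕ 𝕊(d)`. -/
abbrev TotalSpace (d : ℕ) : Type := ∀ k : Fin d, plane d k

/-- The point `(x_1 + e_1 y_1, …, x_d + e_d y_d)` of `𝕊^d`. -/
def point (x y : Fin d → ℝ) : TotalSpace d := fun k => planeMk k (x k) (y k)

/-- The upper Scheffers space `𝕊^d_+`: every `e_k`-coefficient of `ζ_k` is positive. -/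
def upperSpace (d : ℕ) : Set (TotalSpace d) :=
  {ζ | ∀ k, 0 < (ζ k : ScheffersAlgebra d).coeff {k}}

/-- `f` is hypercomplex differentiable in the variable `z_k` at `ζ`: the difference quotient
`(f(ζ_1, …, z, …, ζ_d) - f(ζ)) / (z - ζ_k)` has a limit in `𝕊_d` as `z → ζ_k` in `𝕊(k)`, `z ≠ ζ_k`.
The divisor is a nonzero element of `𝕊(k)`, hence a unit of `𝕊_d`. -/
def HypercomplexDifferentiableAt (f : TotalSpace d → ScheffersAlgebra d) (k : Fin d)
    (ζ : TotalSpace d) : Prop :=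
  ∃ L : ScheffersAlgebra d,
    Tendsto (fun z : plane d k => (f (Function.update ζ k z) - f ζ) *
      Ring.inverse ((z - ζ k : plane d k) : ScheffersAlgebra d)) (𝓝[≠] (ζ k)) (𝓝 L)

/-- `f` is holomorphic on `Ω` (to be used for open `Ω`): it is hypercomplex differentiable in each
variable separately at every point of `Ω`. -/
def HolomorphicOn (f : TotalSpace d → ScheffersAlgebra d) (Ω : Set (TotalSpace d)) : Prop :=
  ∀ ζ ∈ Ω, ∀ k, HypercomplexDifferentiableAt f k ζ

/-- Membership in the Hardy space `H²(𝕊^d_+, 𝕊_d)`; only the values of `f` on `𝕊^d_+` matter. -/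
def MemHardy (f : TotalSpace d → ScheffersAlgebra d) : Prop :=
  HolomorphicOn f (upperSpace d) ∧
    (⨆ (y : Fin d → ℝ) (_ : ∀ k, 0 < y k), ∫⁻ x : Fin d → ℝ, ‖f (point x y)‖ₑ ^ 2) < ∞

/-- Membership in `L²(ℝ^d_+, 𝕊_d)`: square integrable on `ℝ^d` and supported on `[0, ∞)^d`
(almost everywhere). -/
def MemL2Plus (g : (Fin d → ℝ) → ScheffersAlgebra d) : Prop :=
  MemLp g 2 volume ∧ ∀ᵐ ω : Fin d → ℝ, ω ∉ Set.Ici (0 : Fin d → ℝ) → g ω = 0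

/-- The kernel `e^{e_1 ω_1 ζ_1} ⋯ e^{e_d ω_d ζ_d}`. -/
def fourierKernel (ω : Fin d → ℝ) (ζ : TotalSpace d) : ScheffersAlgebra d :=
  ∏ k, NormedSpace.exp (gen k * (ω k • (ζ k : ScheffersAlgebra d)))

/-- The (holomorphic) inverse hypercomplex Fourier integral
`(2π)^{-d} ∫ g(ω) e^{e_1 ω_1 ζ_1} ⋯ e^{e_d ω_d ζ_d} dω`. -/
def inverseFourier (g : (Fin d → ℝ) → ScheffersAlgebra d) (ζ : TotalSpace d) :
    ScheffersAlgebra d :=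
  ((2 * Real.pi) ^ d)⁻¹ • ∫ ω : Fin d → ℝ, g ω * fourierKernel ω ζ

/-- `f₀ ∈ L²(ℝ^d, 𝕊_d)` is the usual inverse Fourier transform of the square integrable function
`g`: the limit in `L²` of the inverse Fourier integrals over the cubes `[-R, R]^d` as `R → ∞`. -/
def IsInverseFourierL2 (g f₀ : (Fin d → ℝ) → ScheffersAlgebra d) : Prop :=
  MemLp f₀ 2 volume ∧
    Tendsto (fun R : ℝ => ∫⁻ x : Fin d → ℝ,
      ‖inverseFourier ((Set.Icc (fun _ => -R) (fun _ => R)).indicator g) (point x 0)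
        - f₀ x‖ₑ ^ 2) atTop (𝓝 0)

end ScheffersAlgebra

end

/-! The algebra `𝕊_d` has `2^d` characters into `ℂ`, one for each choice of signs `e_k ↦ ±i`. They
are orthogonal as functions of the signs, so averaging over them (`reconstruct`) recovers an element
from its character values. A character sends `x_k + e_k y_k` to `x_k ± i y_k`. Multiplying by the
same sign gives `±x_k + i y_k`, a point of the upper half plane, and the kernel becomes `e^{i ω ·
z}` for every character. Nonzero elements of `𝕊(k)` are units, so hypercomplex differentiability
passes to and from complex differentiability of the components. The theorem thus reduces to the
Paley–Wiener theorem on a product of upper half planes, applied to each component; reflecting some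
real coordinates preserves Lebesgue measure.

Direct half: at height `y` the transform of `h` is the Fourier transform of `h(ω) e^{-ω · y}`, which
is dominated by `h` on the orthant. Plancherel gives the Hardy bound, and together with dominated
convergence the boundary value (`exists_plancherel`, `lintegral_sub_sq_tendsto_zero`).

Converse half (`SeparatelyHolomorphic.exists_orthantL2`): the mean value inequality for `F²` on
polydiscs bounds `F` away from the boundary, and Schwarz estimates then make `F` jointly continuous.
Multiplying a shift of `F` by `∏ (1 - iε z_k)⁻²` gives integrable slices. Contour shifting makes `∫
Φ(z) e^{-i ω · z}` independent of the height `y`. Letting `y_k → ∞` shows that it vanishes where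
`ω_k < 0`, and letting `y → 0` bounds its `L²` norm by Plancherel and Fatou. The regularisation is
removed by a weak limit in `L²`: evaluation at `z` is the pairing with an `L²` kernel, so weak
convergence determines the transform at every point. -/

noncomputable section

/-! ### Characters of the Scheffers algebra and reconstruction from them -/

namespace ScheffersAlgebra

variable {d : ℕ}

/-- The sign `±1` attached to `k` by the set `ε` of flipped coordinates. -/
def flipSign (ε : Finset (Fin d)) (k : Fin d) : ℝ := if k ∈ ε then -1 else 1

theorem flipSign_mul_self (ε : Finset (Fin d)) (k : Fin d) :
    flipSign ε k * flipSign ε k = 1 := by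
  unfold flipSign; split_ifs <;> norm_num

theorem flipSign_ne_zero (ε : Finset (Fin d)) (k : Fin d) : flipSign ε k ≠ 0 := by
  unfold flipSign; split_ifs <;> norm_num

/-- The image of `e_β` under the character which sends `e_k` to `flipSign ε k * I`. -/
def charBasis (ε β : Finset (Fin d)) : ℂ := ∏ k ∈ β, ((flipSign ε k : ℂ) * Complex.I)

theorem charBasis_eq_prod (ε β : Finset (Fin d)) :
    charBasis ε β = ∏ k, if k ∈ β then (flipSign ε k : ℂ) * Complex.I else 1 := by
  rw [charBasis, Finset.prod_ite_mem, Finset.univ_inter]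

theorem charBasis_empty (ε : Finset (Fin d)) : charBasis ε ∅ = 1 := Finset.prod_empty

theorem charBasis_singleton (ε : Finset (Fin d)) (k : Fin d) :
    charBasis ε {k} = flipSign ε k * Complex.I := Finset.prod_singleton _ _

/-- Compared one coordinate at a time: a generator common to `A` and `B` contributes `(±i)² = -1`,
which is its factor in `unitSign A B`. -/
theorem charBasis_mul (ε A B : Finset (Fin d)) :
    charBasis ε A * charBasis ε B = unitSign A B * charBasis ε (A ∆ B) := by
  rw [unitSign_eq_prod]
  push_cast
  simp only [charBasis_eq_prod, ← Finset.prod_mul_distrib]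
  refine Finset.prod_congr rfl fun k _ => ?_
  have h : ((flipSign ε k : ℂ)) * flipSign ε k = 1 := by
    exact_mod_cast flipSign_mul_self ε k
  by_cases hA : k ∈ A <;> by_cases hB : k ∈ B <;> simp [Finset.mem_symmDiff, hA, hB]
  linear_combination (-1 : ℂ) * h + (flipSign ε k : ℂ) * flipSign ε k * Complex.I_mul_I

theorem conj_charBasis_mul_self (ε A : Finset (Fin d)) :
    (starRingEnd ℂ) (charBasis ε A) * charBasis ε A = 1 := by
  rw [charBasis, map_prod, ← Finset.prod_mul_distrib]
  refine Finset.prod_eq_one fun k _ => ?_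
  have h : ((flipSign ε k : ℂ)) * flipSign ε k = 1 := by
    exact_mod_cast flipSign_mul_self ε k
  simp only [map_mul, Complex.conj_ofReal, Complex.conj_I]
  linear_combination h - (flipSign ε k : ℂ) * flipSign ε k * Complex.I_mul_I

theorem unitSign_mul_self (A B : Finset (Fin d)) : unitSign A B * unitSign A B = 1 := by
  rw [unitSign, ← mul_pow]; simp

/-- Character values of basis elements have modulus one, so conjugation inverts them in the product
rule for `B` and `B ∆ C`. This is what makes `reconstruct` linear over `𝕊_d`. -/
theorem conj_charBasis_mul (ε B C : Finset (Fin d)) :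
    (starRingEnd ℂ) (charBasis ε C) * charBasis ε B
      = unitSign B (B ∆ C) * (starRingEnd ℂ) (charBasis ε (B ∆ C)) := by
  have h := charBasis_mul ε B (B ∆ C)
  rw [symmDiff_symmDiff_cancel_left] at h
  have h' := congrArg (starRingEnd ℂ) h
  simp only [map_mul, Complex.conj_ofReal] at h'
  have h1 := conj_charBasis_mul_self ε B
  have h2 : ((unitSign B (B ∆ C) : ℂ)) * unitSign B (B ∆ C) = 1 := by
    exact_mod_cast unitSign_mul_self B (B ∆ C)
  linear_combination (-(starRingEnd ℂ) (charBasis ε C) * charBasis ε B) * h2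
    - (unitSign B (B ∆ C) : ℂ) * charBasis ε B * h'
    + (unitSign B (B ∆ C) : ℂ) * (starRingEnd ℂ) (charBasis ε (B ∆ C)) * h1

/-- The character of `𝕊_d` with `e_k ↦ flipSign ε k * I`. -/
def character (ε : Finset (Fin d)) : ScheffersAlgebra d →ₐ[ℝ] ℂ :=
  AlgHom.ofLinearMap
    { toFun := fun w => ∑ β, (w.coeff β : ℂ) * charBasis ε β
      map_add' := fun v w => by simp [add_mul, Finset.sum_add_distrib]
      map_smul' := fun r w => by simp [Finset.mul_sum, mul_assoc] }
    (by simp [coeff_one, charBasis_empty, apply_ite, ite_mul])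
    (fun v w => by
      simp only [LinearMap.coe_mk, AddHom.coe_mk, coeff_mul]
      rw [Finset.sum_mul_sum]
      push_cast
      simp only [Finset.sum_mul]
      rw [Finset.sum_comm]
      refine Finset.sum_congr rfl fun A _ => ?_
      rw [← (symmDiffEquiv A).sum_comp]
      refine Finset.sum_congr rfl fun B _ => ?_
      simp only [symmDiffEquiv, Equiv.coe_fn_mk, symmDiff_symmDiff_cancel_left]
      linear_combination -(v.coeff A : ℂ) * w.coeff B * charBasis_mul ε A B)

theorem character_apply (ε : Finset (Fin d)) (w : ScheffersAlgebra d) :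
    character ε w = ∑ β, (w.coeff β : ℂ) * charBasis ε β := rfl

theorem character_gen (ε : Finset (Fin d)) (k : Fin d) :
    character ε (gen k) = flipSign ε k * Complex.I := by
  simp [character_apply, gen, basisElt, charBasis_singleton, apply_ite, ite_mul]

/-- `character ε` as a continuous real-linear map. -/
def characterL (ε : Finset (Fin d)) : ScheffersAlgebra d →L[ℝ] ℂ :=
  LinearMap.toContinuousLinearMap (character ε).toLinearMap

@[simp] theorem characterL_apply (ε : Finset (Fin d)) (w : ScheffersAlgebra d) :
    characterL ε w = character ε w := rfl

theorem continuous_character (ε : Finset (Fin d)) : Continuous (character (d := d) ε) :=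
  (characterL ε).continuous

/-- The left inverse of `w ↦ (character ε w)_ε` given by averaging over the characters. -/
def reconstructₗ (d : ℕ) : (Finset (Fin d) → ℂ) →ₗ[ℝ] ScheffersAlgebra d where
  toFun c := ofCoeff fun β => (2 ^ d : ℝ)⁻¹ * ∑ ε, ((starRingEnd ℂ) (charBasis ε β) * c ε).re
  map_add' c c' := by
    ext β
    simp only [coeff_ofCoeff, coeff_add, Pi.add_apply, mul_add, Complex.add_re,
      Finset.sum_add_distrib]
  map_smul' r c := by
    ext β
    simp only [coeff_ofCoeff, coeff_smul, Pi.smul_apply, RingHom.id_apply, mul_smul_comm,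
      Complex.smul_re, smul_eq_mul, ← Finset.mul_sum]
    ring

/-- `reconstructₗ` as a continuous linear map. -/
def reconstruct (d : ℕ) : (Finset (Fin d) → ℂ) →L[ℝ] ScheffersAlgebra d :=
  LinearMap.toContinuousLinearMap (reconstructₗ d)

theorem coeff_reconstruct (c : Finset (Fin d) → ℂ) (β : Finset (Fin d)) :
    (reconstruct d c).coeff β
      = (2 ^ d : ℝ)⁻¹ * ∑ ε, ((starRingEnd ℂ) (charBasis ε β) * c ε).re := rfl

/-- `reconstruct` is a map of `𝕊_d`-modules when `𝕊_d` acts on tuples through the characters. Being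
a left inverse then only needs checking at `1`. The tuple `c` is arbitrary, with no compatibility
under conjugation. -/
theorem reconstruct_character_mul (w : ScheffersAlgebra d) (c : Finset (Fin d) → ℂ) :
    reconstruct d (fun ε => character ε w * c ε) = w * reconstruct d c := by
  ext C
  simp only [coeff_mul, coeff_reconstruct, character_apply, Finset.mul_sum, Finset.sum_mul,
    Complex.re_sum]
  rw [Finset.sum_comm]
  refine Finset.sum_congr rfl fun B _ => Finset.sum_congr rfl fun ε _ => ?_
  have h : (starRingEnd ℂ) (charBasis ε C) * (w.coeff B * charBasis ε B * c ε)
      = ((unitSign B (B ∆ C) * w.coeff B : ℝ) : ℂ) *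
        ((starRingEnd ℂ) (charBasis ε (B ∆ C)) * c ε) := by
    push_cast
    linear_combination (w.coeff B : ℂ) * c ε * conj_charBasis_mul ε B C
  rw [h, Complex.re_ofReal_mul]
  ring

/-- Orthogonality of the characters: the sum over sign choices factors into `∏ (1 ± 1)`, and any `k
∈ β` contributes a factor `0`. -/
theorem sum_prod_flipSign (β : Finset (Fin d)) :
    ∑ ε, ∏ k ∈ β, flipSign ε k = if β = ∅ then 2 ^ d else 0 := by
  have h : ∀ ε : Finset (Fin d), ∏ k ∈ β, flipSign ε k
      = ∏ k ∈ ε, (if k ∈ β then (-1 : ℝ) else 1) := by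
    intro ε
    have h1 : ∏ k ∈ β, flipSign ε k = ∏ k, if k ∈ β then flipSign ε k else 1 := by
      rw [Finset.prod_ite_mem, Finset.univ_inter]
    have h2 : ∏ k ∈ ε, (if k ∈ β then (-1 : ℝ) else 1)
        = ∏ k, if k ∈ ε then (if k ∈ β then (-1 : ℝ) else 1) else 1 := by
      rw [Finset.prod_ite_mem Finset.univ ε, Finset.univ_inter]
    rw [h1, h2]
    refine Finset.prod_congr rfl fun k _ => ?_
    by_cases hk : k ∈ β <;> by_cases hk' : k ∈ ε <;> simp [flipSign, hk, hk']
  simp only [h]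
  have h3 := Finset.prod_one_add (f := fun k => if k ∈ β then (-1 : ℝ) else 1)
    (Finset.univ : Finset (Fin d))
  rw [Finset.powerset_univ] at h3
  rw [← h3]
  split_ifs with hβ
  · subst hβ
    norm_num
  · obtain ⟨k, hk⟩ := Finset.nonempty_iff_ne_empty.2 hβ
    exact Finset.prod_eq_zero (Finset.mem_univ k) (by simp [hk])

theorem reconstruct_one : reconstruct d (fun _ => 1) = 1 := by
  ext β
  rw [coeff_reconstruct, coeff_one, ← Complex.re_sum]
  have h : ∑ ε : Finset (Fin d), (starRingEnd ℂ) (charBasis ε β) * 1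
      = ((∑ ε, ∏ k ∈ β, flipSign ε k : ℝ) : ℂ) * (-Complex.I) ^ β.card := by
    push_cast
    rw [Finset.sum_mul]
    refine Finset.sum_congr rfl fun ε _ => ?_
    rw [charBasis, map_prod, mul_one]
    simp only [map_mul, Complex.conj_ofReal, Complex.conj_I, Finset.prod_mul_distrib,
      Finset.prod_const]
  rw [h, sum_prod_flipSign]
  split_ifs with hβ
  · subst hβ
    have h2 : ((2 : ℂ) ^ d).re = 2 ^ d := by
      rw [← Complex.ofReal_ofNat, ← Complex.ofReal_pow, Complex.ofReal_re]
    simp [h2]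
  · simp

/-- An element of `𝕊_d` is determined by its characters. -/
theorem reconstruct_character (w : ScheffersAlgebra d) :
    reconstruct d (fun ε => character ε w) = w := by
  have h := reconstruct_character_mul w (fun _ => 1)
  simpa [reconstruct_one] using h

/-- The exponential series is summed in `ℂ` and carried back by `reconstruct`. For `d ≥ 2` the
Euclidean norm is not submultiplicative, so convergence does not come from a normed algebra
structure. -/
theorem hasSum_exp (w : ScheffersAlgebra d) :
    HasSum (fun n : ℕ => ((n.factorial : ℝ)⁻¹) • w ^ n)
      (reconstruct d fun ε => Complex.exp (character ε w)) := by
  have h : HasSum (fun n : ℕ => fun ε : Finset (Fin d) =>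
      ((n.factorial : ℝ)⁻¹) • (character ε w) ^ n)
      (fun ε => Complex.exp (character ε w)) := by
    refine Pi.hasSum.2 fun ε => ?_
    have := NormedSpace.exp_series_hasSum_exp' (𝕂 := ℝ) (character ε w)
    rwa [← Complex.exp_eq_exp_ℂ] at this
  have h2 := (reconstruct d).hasSum h
  convert h2 using 2 with n
  rw [← reconstruct_character (((n.factorial : ℝ)⁻¹) • w ^ n)]
  congr 1
  ext ε
  rw [map_smul, map_pow]

theorem character_exp (ε : Finset (Fin d)) (w : ScheffersAlgebra d) :
    character ε (NormedSpace.exp w) = Complex.exp (character ε w) := by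
  have h := (hasSum_exp w).summable
  rw [NormedSpace.exp_eq_tsum ℝ, ← characterL_apply, (characterL ε).map_tsum h,
    Complex.exp_eq_exp_ℂ, NormedSpace.exp_eq_tsum ℝ]
  simp only [map_smul, characterL_apply, map_pow]

/-! ### Complex coordinates and the Fourier kernel under a character -/

/-- The complex coordinates of `ζ` seen through a character: at `point x y` the `k`-th one is
`flipSign ε k * x k + I * y k`. -/
def complexCoord (ε : Finset (Fin d)) (ζ : TotalSpace d) (k : Fin d) : ℂ :=
  flipSign ε k * character ε (ζ k)

theorem character_planeMk (ε : Finset (Fin d)) (k : Fin d) (a b : ℝ) :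
    character ε (planeMk k a b : ScheffersAlgebra d) = a + b * (flipSign ε k * Complex.I) := by
  simp [planeMk, character_gen]

theorem planeMk_surjective (k : Fin d) (w : plane d k) : ∃ a b, w = planeMk k a b := by
  obtain ⟨a, b, h⟩ := Submodule.mem_span_pair.1 w.2
  exact ⟨a, b, Subtype.ext h.symm⟩

theorem coeff_planeMk (k : Fin d) (a b : ℝ) :
    (planeMk k a b : ScheffersAlgebra d).coeff {k} = b := by
  simp [planeMk, gen, basisElt, coeff_one]

theorem flipSign_mul_character_planeMk (ε : Finset (Fin d)) (k : Fin d) (a b : ℝ) :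
    (flipSign ε k : ℂ) * character ε (planeMk k a b : ScheffersAlgebra d)
      = (flipSign ε k * a : ℝ) + b * Complex.I := by
  have h : ((flipSign ε k : ℂ)) * flipSign ε k = 1 := by
    exact_mod_cast flipSign_mul_self ε k
  rw [character_planeMk]
  push_cast
  linear_combination b * Complex.I * h

theorem complexCoord_point (ε : Finset (Fin d)) (x y : Fin d → ℝ) (k : Fin d) :
    complexCoord ε (point x y) k = (flipSign ε k * x k : ℝ) + y k * Complex.I :=
  flipSign_mul_character_planeMk ε k (x k) (y k)

/-- The sign in `complexCoord` is there for this: every character sends the upper Scheffers space to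
upper half planes. -/
theorem im_complexCoord (ε : Finset (Fin d)) (ζ : TotalSpace d) (k : Fin d) :
    (complexCoord ε ζ k).im = (ζ k : ScheffersAlgebra d).coeff {k} := by
  obtain ⟨a, b, h⟩ := planeMk_surjective k (ζ k)
  rw [complexCoord, h, flipSign_mul_character_planeMk, coeff_planeMk]
  simp

theorem complexCoord_update (ε : Finset (Fin d)) (ζ : TotalSpace d) (k : Fin d) (w : plane d k) :
    complexCoord ε (Function.update ζ k w)
      = Function.update (complexCoord ε ζ) k (flipSign ε k * character ε w) := by
  ext j
  by_cases h : j = k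
  · subst h
    simp [complexCoord]
  · simp [complexCoord, h]

/-- The exponential `e^{i ω · z}`. -/
def expKernel (ω : Fin d → ℝ) (z : Fin d → ℂ) : ℂ :=
  Complex.exp (Complex.I * ∑ k, ω k * z k)

/-- The sign of `e_k ↦ ±i` is absorbed into the complex coordinate, so one and the same kernel
serves all characters. -/
theorem character_fourierKernel (ε : Finset (Fin d)) (ω : Fin d → ℝ) (ζ : TotalSpace d) :
    character ε (fourierKernel ω ζ) = expKernel ω (complexCoord ε ζ) := by
  rw [fourierKernel, map_prod, expKernel, Finset.mul_sum, Complex.exp_sum]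
  refine Finset.prod_congr rfl fun k _ => ?_
  rw [character_exp, map_mul, character_gen, map_smul, complexCoord, Complex.real_smul]
  congr 1
  ring

/-- The unnormalised Fourier–Laplace integral `∫ h(ω) e^{i ω · z} dω`. -/
def fourierLaplace (h : (Fin d → ℝ) → ℂ) (z : Fin d → ℂ) : ℂ :=
  ∫ ω : Fin d → ℝ, h ω * expKernel ω z

theorem integrable_iff_character {α : Type*} [MeasurableSpace α] {μ : Measure α}
    {u : α → ScheffersAlgebra d} :
    Integrable u μ ↔ ∀ ε, Integrable (fun a => character ε (u a)) μ := by
  constructor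
  · intro h ε
    exact (characterL ε).integrable_comp h
  · intro h
    have h1 : Integrable (fun a => fun ε => character ε (u a)) μ := Integrable.of_eval h
    have h2 := (reconstruct d).integrable_comp h1
    simpa only [reconstruct_character] using h2

theorem integrable_mul_fourierKernel_iff {g : (Fin d → ℝ) → ScheffersAlgebra d}
    {ζ : TotalSpace d} :
    Integrable (fun ω => g ω * fourierKernel ω ζ) ↔
      ∀ ε, Integrable (fun ω => character ε (g ω) * expKernel ω (complexCoord ε ζ)) := by
  rw [integrable_iff_character]
  simp only [map_mul, character_fourierKernel]

theorem character_inverseFourier {g : (Fin d → ℝ) → ScheffersAlgebra d} {ζ : TotalSpace d}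
    (h : Integrable (fun ω => g ω * fourierKernel ω ζ)) (ε : Finset (Fin d)) :
    character ε (inverseFourier g ζ)
      = (((2 * Real.pi) ^ d)⁻¹ : ℝ) • fourierLaplace (fun ω => character ε (g ω))
          (complexCoord ε ζ) := by
  rw [inverseFourier, map_smul, ← characterL_apply, ← (characterL ε).integral_comp_comm h]
  simp only [characterL_apply, map_mul, character_fourierKernel, fourierLaplace]

theorem memLp_iff_character {α : Type*} [MeasurableSpace α] {μ : Measure α} {p : ℝ≥0∞}
    {u : α → ScheffersAlgebra d} :
    MemLp u p μ ↔ ∀ ε, MemLp (fun a => character ε (u a)) p μ := by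
  constructor
  · intro h ε
    exact (characterL ε).comp_memLp' h
  · intro h
    have h1 : MemLp (fun a => fun ε => character ε (u a)) p μ := MemLp.of_eval h
    have h2 := (reconstruct d).comp_memLp' h1
    simpa only [Function.comp_def, reconstruct_character] using h2

end ScheffersAlgebra

/-! ### The `L²` inverse Fourier transform on `L¹ ∩ L²` -/

section PlancherelIntegral

open FourierTransform SchwartzMap
open scoped ContDiff

variable {V : Type*} [NormedAddCommGroup V] [InnerProductSpace ℝ V] [FiniteDimensional ℝ V]
  [MeasurableSpace V] [BorelSpace V]

/-- Fubini, since the pairing `-⟨v, w⟩` in the kernel is symmetric. -/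
theorem integral_fourierInv_mul_eq {f g : V → ℂ} (hf : Integrable f) (hg : Integrable g) :
    ∫ x, 𝓕⁻ f x * g x = ∫ x, f x * 𝓕⁻ g x := by
  have h := VectorFourier.integral_fourierIntegral_smul_eq_flip (𝕜 := ℝ) (e := Real.fourierChar)
    (μ := (volume : Measure V)) (ν := (volume : Measure V)) (L := -innerₗ V) (f := f) (g := g)
    Real.continuous_fourierChar (by
      simp only [LinearMap.neg_apply, innerₗ_apply_apply]
      fun_prop) hf hg
  have hL : (-innerₗ V).flip = -innerₗ V := by
    ext v w
    simp [real_inner_comm]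
  rw [hL] at h
  exact h

theorem continuous_fourierInv {f : V → ℂ} (hf : Integrable f) : Continuous (𝓕⁻ f) :=
  VectorFourier.fourierIntegral_continuous Real.continuous_fourierChar (by
      simp only [LinearMap.neg_apply, innerₗ_apply_apply]
      fun_prop) hf

/-- On `L¹ ∩ L²` the inverse Fourier transform of `L²` is given by the Fourier integral. -/
theorem fourierInv_toLp_ae_eq {f : V → ℂ} (h1 : Integrable f) (h2 : MemLp f 2 volume) :
    (𝓕⁻ (h2.toLp f) : Lp ℂ 2 (volume : Measure V)) =ᵐ[volume] 𝓕⁻ f := by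
  refine ae_eq_of_integral_contDiff_smul_eq
    ((Lp.memLp _).locallyIntegrable (by norm_num))
    (continuous_fourierInv h1).locallyIntegrable fun g hg hgs => ?_
  have hc : HasCompactSupport fun x => (g x : ℂ) := hgs.comp_left Complex.ofReal_zero
  let G : 𝓢(V, ℂ) := hc.toSchwartzMap (Complex.ofRealCLM.contDiff.comp hg)
  have hG : ∀ x, G x = g x := fun x => rfl
  -- Both transforms are tested on a smooth compactly supported function. The `L²` transform is
  -- moved onto it as a tempered distribution, the integral transform by Fubini.
  have key := congrArg (fun T => T G) (Lp.fourierInv_toTemperedDistribution_eq (h2.toLp f))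
  simp only [TemperedDistribution.fourierInv_apply, Lp.toTemperedDistribution_apply] at key
  have e1 : ∫ x, g x • (𝓕⁻ (h2.toLp f) : Lp ℂ 2 (volume : Measure V)) x
      = ∫ x, G x • (𝓕⁻ (h2.toLp f) : Lp ℂ 2 (volume : Measure V)) x := by
    refine integral_congr_ae (Eventually.of_forall fun x => ?_)
    simp only [hG, Complex.real_smul, smul_eq_mul]
  have e2 : ∫ x, g x • 𝓕⁻ f x = ∫ x, 𝓕⁻ f x * G x := by
    refine integral_congr_ae (Eventually.of_forall fun x => ?_)
    simp only [hG, Complex.real_smul, mul_comm]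
  rw [e1, e2, ← key, integral_fourierInv_mul_eq h1 G.integrable]
  refine integral_congr_ae ?_
  filter_upwards [h2.coeFn_toLp] with x hx
  rw [hx, smul_eq_mul, mul_comm, SchwartzMap.fourierInv_coe]

end PlancherelIntegral

theorem eLpNorm_two_sq {α E : Type*} [MeasurableSpace α] {μ : Measure α} [NormedAddCommGroup E]
    (f : α → E) : eLpNorm f 2 μ ^ 2 = ∫⁻ x, ‖f x‖ₑ ^ 2 ∂μ := by
  have h := eLpNorm_nnreal_pow_eq_lintegral (f := f) (μ := μ) (p := 2) two_ne_zero
  simpa using h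

theorem memLp_two_of_lintegral_lt_top {α E : Type*} [MeasurableSpace α] {μ : Measure α}
    [NormedAddCommGroup E] {f : α → E} (hf : AEStronglyMeasurable f μ)
    (h : ∫⁻ x, ‖f x‖ₑ ^ 2 ∂μ < ∞) : MemLp f 2 μ := by
  refine ⟨hf, ?_⟩
  rw [← eLpNorm_two_sq] at h
  by_contra hc
  rw [not_lt_top_iff.1 hc] at h
  simp at h

theorem MeasureTheory.MemLp.lintegral_sq_lt_top {α E : Type*} [MeasurableSpace α] {μ : Measure α}
    [NormedAddCommGroup E] {f : α → E} (hf : MemLp f 2 μ) : ∫⁻ x, ‖f x‖ₑ ^ 2 ∂μ < ∞ := by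
  rw [← eLpNorm_two_sq]
  exact ENNReal.pow_lt_top hf.2

/-! ### Plancherel and Fourier inversion for the kernel `e^{i ω · x}` -/

namespace ScheffersAlgebra

variable {d : ℕ}

theorem ofReal_two_pi_pow_ne_zero : ENNReal.ofReal ((2 * Real.pi) ^ d) ≠ 0 := by
  have := Real.pi_pos
  simp only [ne_eq, ENNReal.ofReal_eq_zero, not_le]
  positivity

/-- The dilation by `(2π)⁻¹`, with values in the Euclidean space. -/
def dilation (d : ℕ) (x : Fin d → ℝ) : EuclideanSpace ℝ (Fin d) :=
  WithLp.toLp 2 ((2 * Real.pi)⁻¹ • x)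

/-- `𝓕⁻` has the kernel `e^{2πi⟨v, x⟩}`; the dilation turns it into `e^{i ω · x}`, and its Jacobian
is the constant `(2π)^d` in Plancherel. -/
theorem map_dilation : Measure.map (dilation d) volume
    = ENNReal.ofReal ((2 * Real.pi) ^ d) • volume := by
  have hpi := Real.pi_pos
  have h0 : (2 * Real.pi)⁻¹ ≠ 0 := by positivity
  have h1 : dilation d = (WithLp.toLp 2) ∘ ((2 * Real.pi)⁻¹ • · : (Fin d → ℝ) → (Fin d → ℝ)) := rfl
  rw [h1, ← Measure.map_map (PiLp.volume_preserving_toLp _).measurable (measurable_const_smul _),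
    Measure.map_addHaar_smul _ h0, Measure.map_smul, (PiLp.volume_preserving_toLp _).map_eq]
  congr 2
  rw [Module.finrank_fin_fun, inv_pow, inv_inv, abs_of_pos (by positivity)]

theorem measurableEmbedding_dilation : MeasurableEmbedding (dilation d) := by
  have hpi := Real.pi_pos
  have h0 : (2 * Real.pi)⁻¹ ≠ 0 := by positivity
  exact (MeasurableEquiv.toLp 2 (Fin d → ℝ)).measurableEmbedding.comp
    (measurableEmbedding_const_smul₀ h0)

theorem lintegral_comp_dilation (f : EuclideanSpace ℝ (Fin d) → ℝ≥0∞) :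
    ∫⁻ x, f (dilation d x) = ENNReal.ofReal ((2 * Real.pi) ^ d) * ∫⁻ x, f x := by
  rw [← measurableEmbedding_dilation.lintegral_map, map_dilation, lintegral_smul_measure,
    smul_eq_mul]

theorem quasiMeasurePreserving_dilation :
    Measure.QuasiMeasurePreserving (dilation d) volume volume := by
  refine ⟨measurableEmbedding_dilation.measurable, ?_⟩
  rw [map_dilation]
  exact Measure.smul_absolutelyContinuous

theorem continuous_dilation : Continuous (dilation d) := by
  unfold dilation
  fun_prop

/-- The real points of `ℂ^d`. -/
def realPoint (x : Fin d → ℝ) : Fin d → ℂ := fun k => x k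

open FourierTransform in
theorem fourierLaplace_realPoint (h : (Fin d → ℝ) → ℂ) (x : Fin d → ℝ) :
    fourierLaplace h (realPoint x)
      = 𝓕⁻ (fun v : EuclideanSpace ℝ (Fin d) => h (WithLp.ofLp v)) (dilation d x) := by
  rw [Real.fourierInv_eq', fourierLaplace, ← (PiLp.volume_preserving_ofLp (Fin d)).integral_comp
    (MeasurableEquiv.toLp 2 (Fin d → ℝ)).symm.measurableEmbedding]
  refine integral_congr_ae (Eventually.of_forall fun v => ?_)
  have hpi : (2 * (Real.pi : ℂ)) ≠ 0 := by
    simp [Real.pi_ne_zero]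
  simp only [smul_eq_mul]
  rw [mul_comm, expKernel]
  congr 2
  simp only [dilation, realPoint, PiLp.inner_apply, Pi.smul_apply, smul_eq_mul,
    RCLike.inner_apply, conj_trivial]
  push_cast
  rw [Finset.mul_sum, Finset.mul_sum, Finset.sum_mul]
  refine Finset.sum_congr rfl fun k _ => ?_
  field_simp

theorem continuous_fourierLaplace_realPoint {h : (Fin d → ℝ) → ℂ} (h1 : Integrable h) :
    Continuous fun x => fourierLaplace h (realPoint x) := by
  simp only [fourierLaplace_realPoint]
  refine (continuous_fourierInv ?_).comp continuous_dilation
  exact ((PiLp.volume_preserving_ofLp (Fin d)).integrable_comp_emb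
    (MeasurableEquiv.toLp 2 (Fin d → ℝ)).symm.measurableEmbedding).2 h1

open FourierTransform in
/-- **Plancherel**: every `h ∈ L²` has a transform in `L²`, at distance comparable with the
distance of `h` to the Fourier integrals of functions of `L¹ ∩ L²`. -/
theorem exists_plancherel {h : (Fin d → ℝ) → ℂ} (h2 : MemLp h 2 volume) :
    ∃ F : (Fin d → ℝ) → ℂ, MemLp F 2 volume ∧ ∀ h' : (Fin d → ℝ) → ℂ, Integrable h' →
      MemLp h' 2 volume → ∫⁻ x, ‖fourierLaplace h' (realPoint x) - F x‖ₑ ^ 2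
        = ENNReal.ofReal ((2 * Real.pi) ^ d) * ∫⁻ ω, ‖h' ω - h ω‖ₑ ^ 2 := by
  have hmp := PiLp.volume_preserving_ofLp (Fin d)
  have hemb : MeasurableEmbedding (WithLp.ofLp : EuclideanSpace ℝ (Fin d) → Fin d → ℝ) :=
    (MeasurableEquiv.toLp 2 (Fin d → ℝ)).symm.measurableEmbedding
  have H2 : MemLp (fun v : EuclideanSpace ℝ (Fin d) => h (WithLp.ofLp v)) 2 volume :=
    h2.comp_measurePreserving hmp
  let T : Lp ℂ 2 (volume : Measure (EuclideanSpace ℝ (Fin d))) := 𝓕⁻ (H2.toLp _)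
  have hT : AEStronglyMeasurable (fun x => T (dilation d x)) volume :=
    (Lp.memLp T).1.comp_quasiMeasurePreserving quasiMeasurePreserving_dilation
  refine ⟨fun x => T (dilation d x), memLp_two_of_lintegral_lt_top hT ?_, ?_⟩
  · rw [lintegral_comp_dilation (fun v => ‖T v‖ₑ ^ 2)]
    exact ENNReal.mul_lt_top ENNReal.ofReal_lt_top (Lp.memLp T).lintegral_sq_lt_top
  · intro h' h1' h2'
    have H2' : MemLp (fun v : EuclideanSpace ℝ (Fin d) => h' (WithLp.ofLp v)) 2 volume :=
      h2'.comp_measurePreserving hmp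
    have H1' : Integrable (fun v : EuclideanSpace ℝ (Fin d) => h' (WithLp.ofLp v)) :=
      (hmp.integrable_comp_emb hemb).2 h1'
    simp only [fourierLaplace_realPoint]
    rw [lintegral_comp_dilation (fun v => ‖𝓕⁻ (fun v : EuclideanSpace ℝ (Fin d) =>
      h' (WithLp.ofLp v)) v - T v‖ₑ ^ 2)]
    congr 1
    have e1 : ∫⁻ v, ‖𝓕⁻ (fun v : EuclideanSpace ℝ (Fin d) => h' (WithLp.ofLp v)) v - T v‖ₑ ^ 2
        = ∫⁻ v, ‖(𝓕⁻ (H2'.toLp _) - T : Lp ℂ 2 (volume : Measure (EuclideanSpace ℝ (Fin d)))) v‖ₑ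
          ^ 2 := by
      refine lintegral_congr_ae ?_
      filter_upwards [fourierInv_toLp_ae_eq H1' H2', Lp.coeFn_sub (𝓕⁻ (H2'.toLp _)) T]
        with v hv1 hv2
      rw [hv2, Pi.sub_apply, hv1]
    have e2 : ∫⁻ ω, ‖h' ω - h ω‖ₑ ^ 2
        = ∫⁻ v, ‖(H2'.toLp _ - H2.toLp _ : Lp ℂ 2 (volume : Measure (EuclideanSpace ℝ (Fin d)))) v‖ₑ
          ^ 2 := by
      rw [← hmp.lintegral_comp_emb hemb]
      refine lintegral_congr_ae ?_
      filter_upwards [H2'.coeFn_toLp, H2.coeFn_toLp, Lp.coeFn_sub (H2'.toLp _) (H2.toLp _)]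
        with v hv1 hv2 hv3
      rw [hv3, Pi.sub_apply, hv1, hv2]
    have e3 : 𝓕⁻ (H2'.toLp _) - T = (Lp.fourierTransformₗᵢ _ ℂ).symm (H2'.toLp _ - H2.toLp _) :=
      (map_sub (Lp.fourierTransformₗᵢ (EuclideanSpace ℝ (Fin d)) ℂ).symm _ _).symm
    rw [e1, e2, ← eLpNorm_two_sq, ← eLpNorm_two_sq, e3, ← Lp.enorm_def, ← Lp.enorm_def,
      LinearIsometryEquiv.enorm_map]

theorem plancherel {h : (Fin d → ℝ) → ℂ} (h1 : Integrable h) (h2 : MemLp h 2 volume) :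
    ∫⁻ x, ‖fourierLaplace h (realPoint x)‖ₑ ^ 2
      = ENNReal.ofReal ((2 * Real.pi) ^ d) * ∫⁻ ω, ‖h ω‖ₑ ^ 2 := by
  -- The transform attached to `h = 0` is at `L²` distance zero from the Fourier integral of `0`, so
  -- it vanishes almost everywhere and the distance formula becomes Plancherel's identity.
  obtain ⟨F, hF, hFh⟩ := exists_plancherel (d := d) (h := 0) MemLp.zero
  have h0 := hFh 0 (integrable_zero _ _ _) MemLp.zero
  have hF0 : F =ᵐ[volume] 0 := by
    have hz : ∫⁻ x, ‖F x‖ₑ ^ 2 = 0 := by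
      simpa [fourierLaplace] using h0
    rw [lintegral_eq_zero_iff' (hF.1.enorm.pow_const 2)] at hz
    filter_upwards [hz] with x hx
    simpa using hx
  rw [show ∫⁻ ω, ‖h ω‖ₑ ^ 2 = ∫⁻ ω, ‖h ω - (0 : (Fin d → ℝ) → ℂ) ω‖ₑ ^ 2 by simp, ← hFh h h1 h2]
  refine lintegral_congr_ae ?_
  filter_upwards [hF0] with x hx
  rw [hx]
  simp

open FourierTransform in
/-- Fourier inversion for `φ` continuous and integrable with integrable transform. -/
theorem fourierLaplace_inversion {φ : (Fin d → ℝ) → ℂ} (hc : Continuous φ) (h1 : Integrable φ)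
    (h2 : Integrable fun ω => fourierLaplace φ (realPoint (-ω))) (x : Fin d → ℝ) :
    fourierLaplace (fun ω => fourierLaplace φ (realPoint (-ω))) (realPoint x)
      = ((2 * Real.pi) ^ d : ℝ) • φ x := by
  have hpi := Real.pi_pos
  have hmp := PiLp.volume_preserving_ofLp (Fin d)
  have hemb : MeasurableEmbedding (WithLp.ofLp : EuclideanSpace ℝ (Fin d) → Fin d → ℝ) :=
    (MeasurableEquiv.toLp 2 (Fin d → ℝ)).symm.measurableEmbedding
  set Φ : EuclideanSpace ℝ (Fin d) → ℂ := fun v => φ (WithLp.ofLp v) with hΦ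
  have hΦc : Continuous Φ := hc.comp (PiLp.continuous_ofLp 2 _)
  have hΦ1 : Integrable Φ := (hmp.integrable_comp_emb hemb).2 h1
  have e : ∀ ω, fourierLaplace φ (realPoint (-ω)) = 𝓕 Φ (dilation d ω) := by
    intro ω
    rw [fourierLaplace_realPoint, Real.fourierInv_eq_fourier_neg]
    simp [dilation]
    rfl
  have hI : Integrable (𝓕 Φ) := by
    simp only [e] at h2
    have h3 := (measurableEmbedding_dilation.integrable_map_iff (μ := volume) (g := 𝓕 Φ)).2 h2
    rw [map_dilation] at h3
    exact (integrable_smul_measure ofReal_two_pi_pow_ne_zero ENNReal.ofReal_ne_top).1 h3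
  have inv := congrFun (hΦc.fourierInv_fourier_eq hΦ1 hI) (WithLp.toLp 2 x)
  rw [show Φ (WithLp.toLp 2 x) = φ x from rfl] at inv
  rw [← inv, Real.fourierInv_eq', fourierLaplace]
  -- The substitution `v = ω / 2π` in the inversion integral; this is the source of the factor
  -- `(2π)^d`.
  have e2 : ∫ v, Complex.exp (((2 * Real.pi * inner ℝ v (WithLp.toLp 2 x) : ℝ) : ℂ) * Complex.I)
        • 𝓕 Φ v = ((2 * Real.pi) ^ d : ℝ)⁻¹ • ∫ ω : Fin d → ℝ, Complex.exp (((2 * Real.pi *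
          inner ℝ (dilation d ω) (WithLp.toLp 2 x) : ℝ) : ℂ) * Complex.I) • 𝓕 Φ (dilation d ω) := by
    rw [← measurableEmbedding_dilation.integral_map (fun v =>
      Complex.exp (((2 * Real.pi * inner ℝ v (WithLp.toLp 2 x) : ℝ) : ℂ) * Complex.I) • 𝓕 Φ v),
      map_dilation, integral_smul_measure, smul_smul, ENNReal.toReal_ofReal (by positivity),
      inv_mul_cancel₀ (by positivity), one_smul]
  rw [e2, smul_smul, mul_inv_cancel₀ (by positivity), one_smul]
  refine integral_congr_ae (Eventually.of_forall fun ω => ?_)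
  have hpi : (2 * (Real.pi : ℂ)) ≠ 0 := by
    simp [Real.pi_ne_zero]
  simp only [smul_eq_mul]
  rw [e, mul_comm, expKernel]
  congr 2
  simp only [dilation, realPoint, PiLp.inner_apply, Pi.smul_apply, smul_eq_mul,
    RCLike.inner_apply, conj_trivial]
  push_cast
  rw [Finset.mul_sum, Finset.mul_sum, Finset.sum_mul]
  refine Finset.sum_congr rfl fun k _ => ?_
  field_simp

/-! ### The Fourier–Laplace transform of `L²` functions on the orthant -/

/-- The points of `ℂ^d` all of whose coordinates lie in the upper half plane. -/
def upperPolyplane (d : ℕ) : Set (Fin d → ℂ) := {z | ∀ k, 0 < (z k).im}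

/-- The point `x + i y` of `ℂ^d`. -/
def complexPoint (x y : Fin d → ℝ) : Fin d → ℂ := fun k => x k + y k * Complex.I

theorem im_complexPoint (x y : Fin d → ℝ) (k : Fin d) : (complexPoint x y k).im = y k := by
  simp [complexPoint]

theorem norm_expKernel (ω : Fin d → ℝ) (z : Fin d → ℂ) :
    ‖expKernel ω z‖ = Real.exp (-∑ k, ω k * (z k).im) := by
  rw [expKernel, Complex.norm_exp]
  congr 1
  simp [Complex.mul_re, Complex.im_sum, Complex.mul_im]

theorem continuous_expKernel (z : Fin d → ℂ) : Continuous fun ω => expKernel ω z := by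
  unfold expKernel
  fun_prop

theorem expKernel_complexPoint (ω x y : Fin d → ℝ) :
    expKernel ω (complexPoint x y)
      = expKernel ω (realPoint x) * (Real.exp (-∑ k, ω k * y k) : ℝ) := by
  rw [expKernel, expKernel, Complex.ofReal_exp, ← Complex.exp_add]
  congr 1
  simp only [complexPoint, realPoint]
  push_cast
  rw [Finset.mul_sum, Finset.mul_sum, ← Finset.sum_neg_distrib, ← Finset.sum_add_distrib]
  refine Finset.sum_congr rfl fun k _ => ?_
  linear_combination (ω k * y k : ℂ) * Complex.I_mul_I

/-- The exponential `e^{-ω · y}` cut off to the orthant `[0, ∞)^d`. -/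
def orthantExp (y ω : Fin d → ℝ) : ℝ :=
  ∏ k, (Set.Ici (0 : ℝ)).indicator (fun t => Real.exp (-(y k) * t)) (ω k)

theorem orthantExp_of_mem {y ω : Fin d → ℝ} (hω : ω ∈ Set.Ici (0 : Fin d → ℝ)) :
    orthantExp y ω = Real.exp (-∑ k, ω k * y k) := by
  rw [orthantExp, ← Finset.sum_neg_distrib, Real.exp_sum]
  refine Finset.prod_congr rfl fun k _ => ?_
  rw [Set.indicator_of_mem (show ω k ∈ Set.Ici (0 : ℝ) from hω k)]
  congr 1
  ring

theorem integrable_orthantExp {y : Fin d → ℝ} (hy : ∀ k, 0 < y k) :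
    Integrable (orthantExp y) := by
  refine Integrable.fintype_prod
    (f := fun k t => (Set.Ici (0 : ℝ)).indicator (fun t => Real.exp (-(y k) * t)) t) fun k => ?_
  rw [integrable_indicator_iff measurableSet_Ici, integrableOn_Ici_iff_integrableOn_Ioi]
  exact exp_neg_integrableOn_Ioi 0 (hy k)

/-- The family is closed under squaring, so square integrability follows from integrability. -/
theorem orthantExp_sq (y ω : Fin d → ℝ) : orthantExp y ω ^ 2 = orthantExp (2 • y) ω := by
  rw [orthantExp, orthantExp, ← Finset.prod_pow]
  refine Finset.prod_congr rfl fun k _ => ?_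
  by_cases h : ω k ∈ Set.Ici (0 : ℝ)
  · rw [Set.indicator_of_mem h, Set.indicator_of_mem h, ← Real.exp_nat_mul]
    congr 1
    simp
    ring
  · rw [Set.indicator_of_notMem h, Set.indicator_of_notMem h]
    simp

theorem memLp_orthantExp {y : Fin d → ℝ} (hy : ∀ k, 0 < y k) :
    MemLp (orthantExp y) 2 volume := by
  rw [memLp_two_iff_integrable_sq (integrable_orthantExp hy).1]
  simp only [orthantExp_sq]
  exact integrable_orthantExp fun k => by simpa using hy k

/-- Square integrability on `ℝ^d` with support in `[0, ∞)^d`, for complex functions. -/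
def OrthantL2 (h : (Fin d → ℝ) → ℂ) : Prop :=
  MemLp h 2 volume ∧ ∀ᵐ ω : Fin d → ℝ, ω ∉ Set.Ici (0 : Fin d → ℝ) → h ω = 0

/-- One null set serves all `z` at once, as differentiation under the integral sign requires. -/
theorem OrthantL2.norm_mul_expKernel {h : (Fin d → ℝ) → ℂ} (hh : OrthantL2 h) :
    ∀ᵐ ω : Fin d → ℝ, ∀ z, ‖h ω * expKernel ω z‖ = ‖h ω‖ * orthantExp (fun k => (z k).im) ω := by
  filter_upwards [hh.2] with ω hω z
  by_cases hm : ω ∈ Set.Ici (0 : Fin d → ℝ)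
  · rw [norm_mul, norm_expKernel, orthantExp_of_mem hm]
  · simp [hω hm]

theorem OrthantL2.integrable_norm_mul_orthantExp {h : (Fin d → ℝ) → ℂ} (hh : OrthantL2 h)
    {y : Fin d → ℝ} (hy : ∀ k, 0 < y k) : Integrable fun ω => ‖h ω‖ * orthantExp y ω :=
  hh.1.norm.integrable_mul (memLp_orthantExp hy)

theorem OrthantL2.integrable_mul_expKernel {h : (Fin d → ℝ) → ℂ} (hh : OrthantL2 h)
    {z : Fin d → ℂ} (hz : z ∈ upperPolyplane d) : Integrable fun ω => h ω * expKernel ω z := by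
  refine (hh.integrable_norm_mul_orthantExp (y := fun k => (z k).im) hz).mono'
    (hh.1.1.mul (continuous_expKernel z).aestronglyMeasurable) ?_
  filter_upwards [hh.norm_mul_expKernel] with ω hω
  exact (hω z).le

theorem expKernel_update (ω : Fin d → ℝ) (z : Fin d → ℂ) (k : Fin d) (w : ℂ) :
    expKernel ω (Function.update z k w)
      = expKernel ω (Function.update z k 0) * Complex.exp (Complex.I * ω k * w) := by
  rw [expKernel, expKernel, ← Complex.exp_add]
  congr 1
  rw [← Finset.add_sum_erase _ _ (Finset.mem_univ k), ← Finset.add_sum_erase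
    (f := fun j => (ω j : ℂ) * Function.update z k 0 j) _ (Finset.mem_univ k)]
  have h : ∀ j ∈ Finset.univ.erase k, (ω j : ℂ) * Function.update z k w j
      = ω j * Function.update z k 0 j := by
    intro j hj
    rw [Function.update_of_ne (Finset.ne_of_mem_erase hj),
      Function.update_of_ne (Finset.ne_of_mem_erase hj)]
  rw [Finset.sum_congr rfl h]
  simp only [Function.update_self]
  ring

theorem hasDerivAt_expKernel_update (ω : Fin d → ℝ) (z : Fin d → ℂ) (k : Fin d) (w : ℂ) :
    HasDerivAt (fun w => expKernel ω (Function.update z k w))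
      (Complex.I * ω k * expKernel ω (Function.update z k w)) w := by
  have e : (fun w => expKernel ω (Function.update z k w)) = fun w =>
      expKernel ω (Function.update z k 0) * Complex.exp (Complex.I * ω k * w) :=
    funext (expKernel_update ω z k)
  rw [e, expKernel_update ω z k w]
  have h : HasDerivAt (fun w : ℂ => Complex.I * ω k * w) (Complex.I * ω k) w := by
    simpa using (hasDerivAt_id w).const_mul (Complex.I * (ω k : ℂ))
  exact (h.cexp.const_mul _).congr_deriv (by ring)

/-- The factor `ω_k`, created by differentiating the kernel, is paid for with half of the decay: `t
ω_k ≤ e^{t ω_k}`. The right side is a bound independent of the height `s ≥ 2t`. -/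
theorem mul_orthantExp_update_le {y ω : Fin d → ℝ} {k : Fin d} {s t : ℝ} (ht : 0 < t)
    (hst : 2 * t ≤ s) :
    |ω k| * orthantExp (Function.update y k s) ω
      ≤ t⁻¹ * orthantExp (Function.update y k t) ω := by
  rw [orthantExp, orthantExp, ← Finset.mul_prod_erase _ _ (Finset.mem_univ k),
    ← Finset.mul_prod_erase (f := fun j => (Set.Ici (0 : ℝ)).indicator
      (fun u => Real.exp (-(Function.update y k t j) * u)) (ω j)) _ (Finset.mem_univ k)]
  have h : ∀ j ∈ Finset.univ.erase k, (Set.Ici (0 : ℝ)).indicator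
      (fun u => Real.exp (-(Function.update y k s j) * u)) (ω j) = (Set.Ici (0 : ℝ)).indicator
      (fun u => Real.exp (-(Function.update y k t j) * u)) (ω j) := by
    intro j hj
    rw [Function.update_of_ne (Finset.ne_of_mem_erase hj),
      Function.update_of_ne (Finset.ne_of_mem_erase hj)]
  rw [Finset.prod_congr rfl h, ← mul_assoc, ← mul_assoc]
  refine mul_le_mul_of_nonneg_right ?_ (Finset.prod_nonneg fun j _ =>
    Set.indicator_nonneg (fun _ _ => (Real.exp_pos _).le) _)
  simp only [Function.update_self]
  by_cases hm : ω k ∈ Set.Ici (0 : ℝ)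
  · have hω : 0 ≤ ω k := hm
    rw [Set.indicator_of_mem hm, Set.indicator_of_mem hm, abs_of_nonneg hω]
    have h1 : ω k ≤ t⁻¹ * Real.exp (t * ω k) := by
      rw [inv_mul_eq_div, le_div_iff₀ ht, mul_comm]
      exact (lt_add_one _).le.trans (Real.add_one_le_exp _)
    calc ω k * Real.exp (-s * ω k)
        ≤ (t⁻¹ * Real.exp (t * ω k)) * Real.exp (-(2 * t) * ω k) := by
          gcongr
      _ = t⁻¹ * Real.exp (-t * ω k) := by
          rw [mul_assoc, ← Real.exp_add]
          ring_nf
  · rw [Set.indicator_of_notMem hm, Set.indicator_of_notMem hm]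
    simp

/-- The transform of a function in `L²` of the orthant is holomorphic in each variable. -/
theorem OrthantL2.differentiableAt_fourierLaplace {h : (Fin d → ℝ) → ℂ} (hh : OrthantL2 h)
    {z : Fin d → ℂ} (hz : z ∈ upperPolyplane d) (k : Fin d) :
    DifferentiableAt ℂ (fun w => fourierLaplace h (Function.update z k w)) (z k) := by
  have hk := hz k
  set y : Fin d → ℝ := fun j => (z j).im with hy
  -- On the disc of radius `2t` about `z k` the imaginary part stays at least `4t - 2t = 2t`, the
  -- height that `mul_orthantExp_update_le` asks for.
  set t := (z k).im / 4 with ht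
  have ht0 : 0 < t := by positivity
  have hy' : ∀ j, 0 < Function.update y k t j := by
    intro j
    by_cases hj : j = k
    · subst hj; simpa using ht0
    · rw [Function.update_of_ne hj]; exact hz j
  have hm : ∀ w, AEStronglyMeasurable
      (fun ω : Fin d → ℝ => h ω * expKernel ω (Function.update z k w)) volume :=
    fun w => hh.1.1.mul (continuous_expKernel _).aestronglyMeasurable
  refine (hasDerivAt_integral_of_dominated_loc_of_deriv_le
    (F := fun w ω => h ω * expKernel ω (Function.update z k w))
    (F' := fun w ω => h ω * (Complex.I * ω k * expKernel ω (Function.update z k w)))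
    (bound := fun ω => t⁻¹ * (‖h ω‖ * orthantExp (Function.update y k t) ω))
    (Metric.ball_mem_nhds (z k) (ε := 2 * t) (by positivity))
    (Eventually.of_forall hm) ?_ ?_ ?_ ?_ ?_).2.differentiableAt
  · rw [Function.update_eq_self]
    exact hh.integrable_mul_expKernel hz
  · refine hh.1.1.mul (Continuous.aestronglyMeasurable ?_)
    exact (by fun_prop : Continuous fun ω : Fin d → ℝ => Complex.I * (ω k : ℂ)).mul
      (continuous_expKernel _)
  · filter_upwards [hh.norm_mul_expKernel] with ω hω w hw
    have him : 2 * t ≤ w.im := by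
      have h1 := (Complex.abs_im_le_norm (w - z k)).trans (mem_ball_iff_norm.1 hw).le
      rw [Complex.sub_im] at h1
      have := (abs_le.1 h1).1
      linarith
    have e : ‖h ω * (Complex.I * ω k * expKernel ω (Function.update z k w))‖
        = |ω k| * ‖h ω * expKernel ω (Function.update z k w)‖ := by
      simp only [norm_mul, Complex.norm_I, Complex.norm_real, Real.norm_eq_abs]
      ring
    have e2 : (fun j => (Function.update z k w j).im) = Function.update y k w.im := by
      ext j
      by_cases hj : j = k
      · subst hj; simp
      · simp [hj, hy]
    rw [e, hω, e2, mul_left_comm, mul_left_comm t⁻¹]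
    exact mul_le_mul_of_nonneg_left (mul_orthantExp_update_le ht0 him) (norm_nonneg _)
  · exact (hh.integrable_norm_mul_orthantExp hy').const_mul _
  · exact Eventually.of_forall fun ω w _ => (hasDerivAt_expKernel_update ω z k w).const_mul _

/-- The function `h(ω) e^{-ω · y}`. -/
def damp (h : (Fin d → ℝ) → ℂ) (y ω : Fin d → ℝ) : ℂ := h ω * (Real.exp (-∑ k, ω k * y k) : ℝ)

/-- Moving to height `y` is the same as damping the function, so Plancherel on real points applies
to every slice. -/
theorem fourierLaplace_complexPoint (h : (Fin d → ℝ) → ℂ) (x y : Fin d → ℝ) :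
    fourierLaplace h (complexPoint x y) = fourierLaplace (damp h y) (realPoint x) := by
  unfold fourierLaplace damp
  refine integral_congr_ae (Eventually.of_forall fun ω => ?_)
  simp only [expKernel_complexPoint]
  ring

theorem aestronglyMeasurable_damp {h : (Fin d → ℝ) → ℂ} (hh : AEStronglyMeasurable h volume)
    (y : Fin d → ℝ) : AEStronglyMeasurable (damp h y) volume :=
  hh.mul (by fun_prop : Continuous fun ω : Fin d → ℝ =>
    ((Real.exp (-∑ k, ω k * y k) : ℝ) : ℂ)).aestronglyMeasurable

theorem OrthantL2.integrable_damp {h : (Fin d → ℝ) → ℂ} (hh : OrthantL2 h)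
    {y : Fin d → ℝ} (hy : ∀ k, 0 < y k) : Integrable (damp h y) := by
  refine (hh.integrable_mul_expKernel (z := complexPoint 0 y)
    fun k => by rw [im_complexPoint]; exact hy k).congr (Eventually.of_forall fun ω => ?_)
  simp only [expKernel_complexPoint, damp]
  simp [expKernel, realPoint]

theorem exp_neg_sum_le_one {y ω : Fin d → ℝ} (hy : ∀ k, 0 ≤ y k)
    (hω : ω ∈ Set.Ici (0 : Fin d → ℝ)) : Real.exp (-∑ k, ω k * y k) ≤ 1 := by
  rw [Real.exp_le_one_iff, neg_nonpos]
  exact Finset.sum_nonneg fun k _ => mul_nonneg (hω k) (hy k)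

theorem OrthantL2.norm_damp_le {h : (Fin d → ℝ) → ℂ} (hh : OrthantL2 h) :
    ∀ᵐ ω, ∀ y : Fin d → ℝ, (∀ k, 0 ≤ y k) → ‖damp h y ω‖ ≤ ‖h ω‖ := by
  filter_upwards [hh.2] with ω hω y hy
  by_cases hm : ω ∈ Set.Ici (0 : Fin d → ℝ)
  · rw [damp, norm_mul, Complex.norm_real, Real.norm_of_nonneg (Real.exp_pos _).le]
    exact mul_le_of_le_one_right (norm_nonneg _) (exp_neg_sum_le_one hy hm)
  · simp [damp, hω hm]

theorem OrthantL2.memLp_damp {h : (Fin d → ℝ) → ℂ} (hh : OrthantL2 h)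
    {y : Fin d → ℝ} (hy : ∀ k, 0 ≤ y k) : MemLp (damp h y) 2 volume :=
  hh.1.mono (aestronglyMeasurable_damp hh.1.1 y) (hh.norm_damp_le.mono fun _ hω => hω y hy)

theorem OrthantL2.lintegral_fourierLaplace_le {h : (Fin d → ℝ) → ℂ} (hh : OrthantL2 h)
    {y : Fin d → ℝ} (hy : ∀ k, 0 < y k) :
    ∫⁻ x, ‖fourierLaplace h (complexPoint x y)‖ₑ ^ 2
      ≤ ENNReal.ofReal ((2 * Real.pi) ^ d) * ∫⁻ ω, ‖h ω‖ₑ ^ 2 := by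
  simp only [fourierLaplace_complexPoint]
  rw [plancherel (hh.integrable_damp hy) (hh.memLp_damp fun k => (hy k).le)]
  refine mul_le_mul_right (lintegral_mono_ae ?_) _
  filter_upwards [hh.norm_damp_le] with ω hω
  gcongr
  exact enorm_le_iff_norm_le.2 (hω y fun k => (hy k).le)

/-- Dominated convergence with the majorant `(2‖h‖)²`. Used both for damping and for truncation to
cubes. -/
theorem lintegral_sub_sq_tendsto_zero {α ι E : Type*} [MeasurableSpace α] {μ : Measure α}
    [NormedAddCommGroup E] {l : Filter ι} [l.IsCountablyGenerated] {u : ι → α → E} {h : α → E}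
    (hh : MemLp h 2 μ) (hu : ∀ᶠ i in l, AEStronglyMeasurable (u i) μ)
    (hb : ∀ᶠ i in l, ∀ᵐ a ∂μ, ‖u i a‖ ≤ ‖h a‖)
    (hlim : ∀ᵐ a ∂μ, Tendsto (fun i => u i a) l (𝓝 (h a))) :
    Tendsto (fun i => ∫⁻ a, ‖u i a - h a‖ₑ ^ 2 ∂μ) l (𝓝 0) := by
  have key := tendsto_lintegral_filter_of_dominated_convergence' (μ := μ) (l := l)
    (F := fun i a => ‖u i a - h a‖ₑ ^ 2) (f := fun _ => 0) (fun a => (2 * ‖h a‖ₑ) ^ 2)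
    (hu.mono fun i hi => (hi.sub hh.1).enorm.pow_const 2)
    (hb.mono fun i hi => hi.mono fun a ha => ?_) ?_ ?_
  · simpa using key
  · gcongr
    rw [two_mul]
    refine (enorm_sub_le).trans ?_
    gcongr
    exact enorm_le_iff_norm_le.2 ha
  · simp only [mul_pow]
    rw [lintegral_const_mul' _ _ (by norm_num)]
    exact ENNReal.mul_ne_top (by norm_num) hh.lintegral_sq_lt_top.ne
  · filter_upwards [hlim] with a ha
    have h1 : Tendsto (fun i => u i a - h a) l (𝓝 0) := by
      simpa using ha.sub_const (h a)
    have h2 := ((ENNReal.continuous_pow 2).tendsto _).comp h1.enorm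
    simpa [Function.comp_def] using h2

/-- With `F` the transform supplied by `exists_plancherel`, the distance of a slice to `F` is a
constant times the distance of `damp h y` to `h`, which tends to zero. -/
theorem OrthantL2.tendsto_lintegral_fourierLaplace {h F : (Fin d → ℝ) → ℂ} (hh : OrthantL2 h)
    (hF : ∀ h' : (Fin d → ℝ) → ℂ, Integrable h' →
      MemLp h' 2 volume → ∫⁻ x, ‖fourierLaplace h' (realPoint x) - F x‖ₑ ^ 2
        = ENNReal.ofReal ((2 * Real.pi) ^ d) * ∫⁻ ω, ‖h' ω - h ω‖ₑ ^ 2) :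
    Tendsto (fun y => ∫⁻ x, ‖fourierLaplace h (complexPoint x y) - F x‖ₑ ^ 2)
      (𝓝[{y | ∀ k, 0 < y k}] 0) (𝓝 0) := by
  have h1 : Tendsto (fun y => ENNReal.ofReal ((2 * Real.pi) ^ d) * ∫⁻ ω, ‖damp h y ω - h ω‖ₑ ^ 2)
      (𝓝[{y | ∀ k, 0 < y k}] 0) (𝓝 0) := by
    rw [← mul_zero (ENNReal.ofReal ((2 * Real.pi) ^ d))]
    refine ENNReal.Tendsto.const_mul ?_ (Or.inr ENNReal.ofReal_ne_top)
    refine lintegral_sub_sq_tendsto_zero hh.1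
      (Eventually.of_forall fun y => aestronglyMeasurable_damp hh.1.1 y) ?_ ?_
    · filter_upwards [self_mem_nhdsWithin] with y hy
      filter_upwards [hh.norm_damp_le] with ω hω
      exact hω y fun k => (hy k).le
    · refine Eventually.of_forall fun ω => Tendsto.mono_left ?_ nhdsWithin_le_nhds
      have hc : Continuous fun y => damp h y ω := by
        unfold damp
        fun_prop
      have := hc.tendsto 0
      simpa [damp] using this
  refine h1.congr' ?_
  filter_upwards [self_mem_nhdsWithin] with y hy
  simp only [fourierLaplace_complexPoint]
  rw [hF _ (hh.integrable_damp hy) (hh.memLp_damp fun k => (hy k).le)]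

theorem integrable_indicator_Icc {h : (Fin d → ℝ) → ℂ} (hh : MemLp h 2 volume) (a b : Fin d → ℝ) :
    Integrable ((Set.Icc a b).indicator h) := by
  rw [integrable_indicator_iff measurableSet_Icc]
  exact (hh.locallyIntegrable (by norm_num)).integrableOn_isCompact isCompact_Icc

theorem tendsto_lintegral_truncation {h F : (Fin d → ℝ) → ℂ} (hh : MemLp h 2 volume)
    (hF : ∀ h' : (Fin d → ℝ) → ℂ, Integrable h' →
      MemLp h' 2 volume → ∫⁻ x, ‖fourierLaplace h' (realPoint x) - F x‖ₑ ^ 2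
        = ENNReal.ofReal ((2 * Real.pi) ^ d) * ∫⁻ ω, ‖h' ω - h ω‖ₑ ^ 2) :
    Tendsto (fun R : ℝ => ∫⁻ x, ‖fourierLaplace
        ((Set.Icc (fun _ => -R) (fun _ => R)).indicator h) (realPoint x) - F x‖ₑ ^ 2)
      atTop (𝓝 0) := by
  have hm : ∀ R : ℝ, MemLp ((Set.Icc (fun _ : Fin d => -R) (fun _ => R)).indicator h) 2 volume :=
    fun R => hh.indicator measurableSet_Icc
  simp only [fun R : ℝ => hF _ (integrable_indicator_Icc hh (fun _ : Fin d => -R) fun _ => R) (hm R)]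
  rw [← mul_zero (ENNReal.ofReal ((2 * Real.pi) ^ d))]
  refine ENNReal.Tendsto.const_mul ?_ (Or.inr ENNReal.ofReal_ne_top)
  refine lintegral_sub_sq_tendsto_zero hh (Eventually.of_forall fun R => (hm R).1)
    (Eventually.of_forall fun R => Eventually.of_forall fun ω => norm_indicator_le_norm_self _ _) ?_
  refine Eventually.of_forall fun ω => tendsto_const_nhds.congr' ?_
  filter_upwards [eventually_ge_atTop ‖ω‖] with R hR
  rw [Set.indicator_of_mem]
  exact ⟨fun k => (abs_le.1 ((norm_le_pi_norm ω k).trans hR)).1,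
    fun k => (abs_le.1 ((norm_le_pi_norm ω k).trans hR)).2⟩

end ScheffersAlgebra

/-! ### Interior bounds and joint continuity of separately holomorphic functions -/

/-- The area mean value inequality on a disc, with a non-optimal constant. -/
theorem enorm_le_lintegral_ball {ψ : ℂ → ℂ} (hm : Measurable ψ) {c : ℂ} {R : ℝ}
    (hd : DifferentiableOn ℂ ψ (Metric.ball c R)) :
    ENNReal.ofReal (R / 2) * ENNReal.ofReal (R / 2) * ENNReal.ofReal (2 * Real.pi) * ‖ψ c‖ₑ
      ≤ ∫⁻ w in Metric.ball c R, ‖ψ w‖ₑ := by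
  have hcirc : ∀ r ∈ Set.Ioo (R / 2) R, 0 < r → ENNReal.ofReal (2 * Real.pi) * ‖ψ c‖ₑ
      ≤ ∫⁻ θ in Set.Ioo (-Real.pi) Real.pi, ‖ψ (circleMap c r θ)‖ₑ := by
    intro r hr hr0
    have hsub : Metric.closedBall c r ⊆ Metric.ball c R := Metric.closedBall_subset_ball hr.2
    have hmv : Real.circleAverage ψ c r = ψ c := by
      refine DiffContOnCl.circleAverage ?_
      rw [abs_of_pos hr0]
      exact (hd.mono hsub).diffContOnCl_ball subset_rfl
    have hper : Function.Periodic (fun θ => ψ (circleMap c r θ)) (2 * Real.pi) := fun θ => by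
      simp only [periodic_circleMap c r θ]
    have hint := hper.intervalIntegral_add_eq 0 (-Real.pi)
    rw [zero_add, show -Real.pi + 2 * Real.pi = Real.pi by ring] at hint
    rw [Real.circleAverage_def, hint, intervalIntegral.integral_of_le (by linarith [Real.pi_pos]),
      integral_Ioc_eq_integral_Ioo] at hmv
    calc ENNReal.ofReal (2 * Real.pi) * ‖ψ c‖ₑ
        = ‖∫ θ in Set.Ioo (-Real.pi) Real.pi, ψ (circleMap c r θ)‖ₑ := by
          rw [← hmv, enorm_smul, ← mul_assoc, Real.enorm_of_nonneg (by positivity),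
            ← ENNReal.ofReal_mul (by positivity), mul_inv_cancel₀ (by positivity),
            ENNReal.ofReal_one, one_mul]
      _ ≤ _ := enorm_integral_le_lintegral_enorm _
  have hshift : ∫⁻ w in Metric.ball c R, ‖ψ w‖ₑ
      = ∫⁻ w, (Metric.ball c R).indicator (fun w => ‖ψ w‖ₑ) (c + w) := by
    rw [lintegral_add_left_eq_self, lintegral_indicator Metric.isOpen_ball.measurableSet]
  have hmi : Measurable ((Metric.ball c R).indicator (fun w => ‖ψ w‖ₑ)) :=
    hm.enorm.indicator Metric.isOpen_ball.measurableSet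
  have hpc : Measurable fun p : ℝ × ℝ => Complex.polarCoord.symm p := by
    have : (fun p : ℝ × ℝ => Complex.polarCoord.symm p)
        = fun p => (p.1 : ℂ) * (Real.cos p.2 + Real.sin p.2 * Complex.I) :=
      funext Complex.polarCoord_symm_apply
    rw [this]
    fun_prop
  have hmp : Measurable fun p : ℝ × ℝ => ENNReal.ofReal p.1 •
      (Metric.ball c R).indicator (fun w => ‖ψ w‖ₑ) (c + Complex.polarCoord.symm p) :=
    (ENNReal.measurable_ofReal.comp measurable_fst).smul
      (hmi.comp (measurable_const.add hpc))
  rw [hshift, ← Complex.lintegral_comp_polarCoord_symm, show polarCoord.target = Set.Ioi 0 ×ˢ Set.Ioo (-Real.pi) Real.pi from rfl,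
    Measure.volume_eq_prod, ← Measure.prod_restrict, lintegral_prod _ hmp.aemeasurable]
  rcases le_or_gt R 0 with hR | hR
  · simp [ENNReal.ofReal_of_nonpos (by linarith : R / 2 ≤ 0)]
  -- Only circles with radius in `(R/2, R)` are kept. One factor `R/2` is the length of this
  -- interval, the other bounds the polar density `r` from below.
  calc ENNReal.ofReal (R / 2) * ENNReal.ofReal (R / 2) * ENNReal.ofReal (2 * Real.pi) * ‖ψ c‖ₑ
      = ∫⁻ r in Set.Ioo (R / 2) R,
          ENNReal.ofReal (R / 2) * (ENNReal.ofReal (2 * Real.pi) * ‖ψ c‖ₑ) := by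
        rw [setLIntegral_const, Real.volume_Ioo, show R - R / 2 = R / 2 by ring]
        ring
    _ ≤ ∫⁻ r in Set.Ioo (R / 2) R, ∫⁻ θ in Set.Ioo (-Real.pi) Real.pi, ENNReal.ofReal r •
          (Metric.ball c R).indicator (fun w => ‖ψ w‖ₑ) (c + Complex.polarCoord.symm (r, θ)) := by
        refine setLIntegral_mono' measurableSet_Ioo fun r hr => ?_
        have hr0 : 0 < r := by linarith [hr.1]
        have e : ∀ θ, c + Complex.polarCoord.symm (r, θ) = circleMap c r θ := by
          intro θ
          rw [Complex.polarCoord_symm_apply, circleMap, Complex.exp_mul_I]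
          simp
        have e2 : ∀ θ, (Metric.ball c R).indicator (fun w => ‖ψ w‖ₑ) (circleMap c r θ)
            = ‖ψ (circleMap c r θ)‖ₑ := by
          intro θ
          refine Set.indicator_of_mem ?_ _
          rw [mem_ball_iff_norm]
          simpa [circleMap, abs_of_pos hr0] using hr.2
        simp only [e, e2, smul_eq_mul]
        rw [lintegral_const_mul' _ _ ENNReal.ofReal_ne_top]
        exact mul_le_mul' (ENNReal.ofReal_le_ofReal hr.1.le) (hcirc r hr hr0)
    _ ≤ _ := lintegral_mono_set fun r hr => lt_trans (by positivity) hr.1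

/-- Separately continuous functions of finitely many variables are Borel measurable. -/
theorem measurable_of_separately_continuous {ι X Y : Type*} [Fintype ι] [DecidableEq ι]
    [TopologicalSpace X] [TopologicalSpace.MetrizableSpace X] [SecondCountableTopology X]
    [MeasurableSpace X] [BorelSpace X]
    [TopologicalSpace Y] [TopologicalSpace.PseudoMetrizableSpace Y]
    [MeasurableSpace Y] [BorelSpace Y] {H : (ι → X) → Y}
    (hH : ∀ z k, Continuous fun w => H (Function.update z k w)) : Measurable H := by
  -- The variables outside `s` are frozen and released one by one. A function continuous in one
  -- argument and measurable in the other is jointly measurable, and is then pulled back along `w ↦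
  -- (w i, w)`.
  have key : ∀ s : Finset ι, ∀ z, Measurable fun w : ι → X => H (s.piecewise w z) := by
    intro s
    induction s using Finset.induction_on with
    | empty =>
      intro z
      simp only [Finset.piecewise_empty]
      exact measurable_const
    | insert i s hi ih =>
      intro z
      have e : ∀ w c, s.piecewise w (Function.update z i c)
          = Function.update (s.piecewise w z) i c := by
        intro w c
        ext j
        by_cases hj : j = i
        · subst hj
          simp [hi]
        · by_cases hjs : j ∈ s <;> simp [hjs, hj]
      have h1 : Measurable (Function.uncurry fun (c : X) (w : ι → X) =>
          H (s.piecewise w (Function.update z i c))) := by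
        refine measurable_uncurry_of_continuous_of_measurable (fun w => ?_) fun c => ih _
        simp only [e]
        exact hH _ _
      have h2 : Measurable fun w : ι → X => (w i, w) :=
        (measurable_pi_apply i).prodMk measurable_id'
      convert h1.comp h2 using 1
      ext w
      simp only [Function.comp_apply, Function.uncurry_apply_pair, e]
      rw [Finset.piecewise_insert]
  rcases isEmpty_or_nonempty (ι → X) with h | ⟨⟨z⟩⟩
  · exact measurable_of_empty H
  · simpa using key Finset.univ z

namespace ScheffersAlgebra

variable {d : ℕ}

/-- Holomorphy in each variable separately on the product of upper half planes. -/
def SeparatelyHolomorphic (F : (Fin d → ℂ) → ℂ) : Prop :=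
  ∀ z ∈ upperPolyplane d, ∀ k, DifferentiableAt ℂ (fun w => F (Function.update z k w)) (z k)

theorem update_mem_upperPolyplane {z : Fin d → ℂ} (hz : z ∈ upperPolyplane d) (k : Fin d) {w : ℂ}
    (hw : 0 < w.im) : Function.update z k w ∈ upperPolyplane d := by
  intro j
  by_cases hj : j = k
  · subst hj
    simpa using hw
  · rw [Function.update_of_ne hj]
    exact hz j

theorem SeparatelyHolomorphic.differentiableAt_update {F : (Fin d → ℂ) → ℂ}
    (hF : SeparatelyHolomorphic F) {z : Fin d → ℂ} (hz : z ∈ upperPolyplane d) (k : Fin d) {w : ℂ}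
    (hw : 0 < w.im) : DifferentiableAt ℂ (fun w => F (Function.update z k w)) w := by
  have h := hF _ (update_mem_upperPolyplane hz k hw) k
  simpa using h

/-- Raise the imaginary part of `w` to at least `δ`. -/
def raiseIm (δ : ℝ) (w : ℂ) : ℂ := w.re + max w.im δ * Complex.I

theorem continuous_raiseIm (δ : ℝ) : Continuous (raiseIm δ) := by
  unfold raiseIm
  fun_prop

theorem raiseIm_of_le {δ : ℝ} {w : ℂ} (h : δ ≤ w.im) : raiseIm δ w = w := by
  rw [raiseIm, max_eq_left h, Complex.re_add_im]

theorem le_im_raiseIm (δ : ℝ) (w : ℂ) : δ ≤ (raiseIm δ w).im := by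
  simp [raiseIm]

/-- Nothing is known of `F` outside the upper half planes. Composition with `raiseIm δ` gives a
separately continuous function on all of `ℂ^d`, unchanged where all imaginary parts are at least
`δ`. -/
theorem SeparatelyHolomorphic.measurable_comp_raiseIm {F : (Fin d → ℂ) → ℂ}
    (hF : SeparatelyHolomorphic F) {δ : ℝ} (hδ : 0 < δ) :
    Measurable fun z : Fin d → ℂ => F fun k => raiseIm δ (z k) := by
  refine measurable_of_separately_continuous fun z k => ?_
  have e : ∀ w, (fun j => raiseIm δ (Function.update z k w j))
      = Function.update (fun j => raiseIm δ (z j)) k (raiseIm δ w) := by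
    intro w
    ext j
    by_cases hj : j = k
    · subst hj
      simp
    · simp [hj]
  simp only [e]
  rw [continuous_iff_continuousAt]
  intro w
  refine ContinuousAt.comp (g := fun w => F (Function.update (fun j => raiseIm δ (z j)) k w)) ?_
    (continuous_raiseIm δ).continuousAt
  exact (hF.differentiableAt_update (fun j => hδ.trans_le (le_im_raiseIm δ (z j))) k
    (hδ.trans_le (le_im_raiseIm δ w))).continuousAt

theorem measurePreserving_complexPoint :
    MeasurePreserving (fun p : (Fin d → ℝ) × (Fin d → ℝ) => complexPoint p.1 p.2) := by
  have h1 := (volume_measurePreserving_arrowProdEquivProdArrow ℝ ℝ (Fin d)).symm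
  have h2 := volume_preserving_pi (fun _ : Fin d => Complex.volume_preserving_equiv_real_prod.symm)
  have h3 := h2.comp h1
  convert h3 using 1
  ext p k
  simp [complexPoint, MeasurableEquiv.arrowProdEquivProdArrow, Equiv.arrowProdEquivProdArrow,
    Complex.measurableEquivRealProd, Complex.equivRealProdCLM_symm_apply]

/-- A separately holomorphic function with uniformly bounded `L²` norms on the planes `Im z = y`
is bounded away from the boundary. -/
theorem SeparatelyHolomorphic.exists_bound {F : (Fin d → ℂ) → ℂ}
    (hF : SeparatelyHolomorphic F) {C : ℝ≥0∞} (hC : C ≠ ∞)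
    (hFC : ∀ y : Fin d → ℝ, (∀ k, 0 < y k) → ∫⁻ x, ‖F (complexPoint x y)‖ₑ ^ 2 ≤ C)
    {δ : ℝ} (hδ : 0 < δ) : ∃ M : ℝ, ∀ z : Fin d → ℂ, (∀ k, δ ≤ (z k).im) → ‖F z‖ ≤ M := by
  set H : (Fin d → ℂ) → ℂ := fun z => F fun k => raiseIm (δ / 2) (z k) with hH
  have hHm : Measurable H := hF.measurable_comp_raiseIm (by positivity)
  have hHF : ∀ z : Fin d → ℂ, (∀ k, δ / 2 ≤ (z k).im) → H z = F z := by
    intro z hz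
    simp only [hH, fun k => raiseIm_of_le (hz k)]
  -- The mean value inequality is applied to the holomorphic function `F²`, whose modulus is the
  -- integrand in the hypothesis.
  set f : (Fin d → ℂ) → ℝ≥0∞ := fun z => ‖H z ^ 2‖ₑ with hf
  have hfm : Measurable f := (hHm.pow_const 2).enorm
  set κ := ENNReal.ofReal (δ / 2 / 2) * ENNReal.ofReal (δ / 2 / 2) * ENNReal.ofReal (2 * Real.pi)
    with hκ
  have hκ0 : κ ≠ 0 := by
    have := Real.pi_pos
    simp only [hκ, ne_eq, mul_eq_zero, ENNReal.ofReal_eq_zero, not_or, not_le]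
    refine ⟨⟨?_, ?_⟩, ?_⟩ <;> positivity
  -- The imaginary parts of a polydisc of radius `δ/2` fill a box of side `δ`, and each height in it
  -- contributes at most `C`.
  set B := ENNReal.ofReal δ ^ d * C with hB
  have main : ∀ z0 : Fin d → ℂ, (∀ k, δ ≤ (z0 k).im) → κ ^ d * f z0 ≤ B := by
    intro z0 hz0
    let μ : Fin d → Measure ℂ := fun k => volume.restrict (Metric.ball (z0 k) (δ / 2))
    have him : ∀ k, ∀ w ∈ Metric.ball (z0 k) (δ / 2), |w.im - (z0 k).im| < δ / 2 := by
      intro k w hw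
      rw [← Complex.sub_im]
      exact (Complex.abs_im_le_norm _).trans_lt (mem_ball_iff_norm.1 hw)
    have him' : ∀ k, ∀ w ∈ Metric.ball (z0 k) (δ / 2), δ / 2 < w.im := by
      intro k w hw
      have h1 := (abs_lt.1 (him k w hw)).1
      have h2 := hz0 k
      linarith
    -- The one-variable inequality is iterated; each integrated variable contributes a factor `κ`.
    have step : ∀ s : Finset (Fin d), ∀ z : Fin d → ℂ, (∀ k ∈ s, z k = z0 k) →
        (∀ k, δ / 2 < (z k).im) → κ ^ s.card * f z ≤ (∫⋯∫⁻_s, f ∂μ) z := by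
      intro s
      induction s using Finset.induction_on with
      | empty =>
        intro z _ _
        simp
      | insert i s hi ih =>
        intro z hz hzim
        rw [lmarginal_insert _ hfm hi, Finset.card_insert_of_notMem hi]
        have hzi : z i = z0 i := hz i (Finset.mem_insert_self i s)
        have hup : z ∈ upperPolyplane d := fun k => lt_trans (by positivity) (hzim k)
        have hm1 : Measurable fun w => H (Function.update z i w) ^ 2 :=
          (hHm.comp (measurable_update z)).pow_const 2
        have hd1 : DifferentiableOn ℂ (fun w => H (Function.update z i w) ^ 2)
            (Metric.ball (z0 i) (δ / 2)) := by
          have hd2 : DifferentiableOn ℂ (fun w => F (Function.update z i w) ^ 2)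
              (Metric.ball (z0 i) (δ / 2)) := fun w hw =>
            ((hF.differentiableAt_update hup i
              (lt_trans (by positivity) (him' i w hw))).pow 2).differentiableWithinAt
          refine hd2.congr fun w hw => ?_
          rw [hHF]
          intro k
          by_cases hk : k = i
          · subst hk
            simpa using (him' k w hw).le
          · rw [Function.update_of_ne hk]
            exact (hzim k).le
        have hb := enorm_le_lintegral_ball hm1 hd1
        rw [← hzi, Function.update_eq_self] at hb
        calc κ ^ (s.card + 1) * f z = κ ^ s.card * (κ * f z) := by ring
          _ ≤ κ ^ s.card * ∫⁻ w in Metric.ball (z i) (δ / 2), f (Function.update z i w) := by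
              gcongr
          _ = ∫⁻ w in Metric.ball (z i) (δ / 2), κ ^ s.card * f (Function.update z i w) :=
              (lintegral_const_mul _ (hfm.comp (measurable_update z))).symm
          _ ≤ ∫⁻ w, (∫⋯∫⁻_s, f ∂μ) (Function.update z i w) ∂μ i := by
              rw [hzi]
              refine setLIntegral_mono' Metric.isOpen_ball.measurableSet fun w hw => ?_
              refine ih _ (fun k hk => ?_) fun k => ?_
              · rw [Function.update_of_ne (by rintro rfl; exact hi hk)]
                exact hz k (Finset.mem_insert_of_mem hk)
              · by_cases hk : k = i
                · subst hk
                  simpa using him' k w hw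
                · rw [Function.update_of_ne hk]
                  exact hzim k
    have h1 := step Finset.univ z0 (fun _ _ => rfl) fun k => by linarith [hz0 k]
    rw [lmarginal_univ, Finset.card_univ, Fintype.card_fin, ← Measure.restrict_pi_pi] at h1
    refine h1.trans ?_
    set box : Set (Fin d → ℝ) :=
      Set.univ.pi fun k => Set.Ioo ((z0 k).im - δ / 2) ((z0 k).im + δ / 2) with hbox
    have hboxm : MeasurableSet box := MeasurableSet.univ_pi fun k => measurableSet_Ioo
    set S : Set (Fin d → ℂ) := {z | (fun k => (z k).im) ∈ box} with hS
    have hSm : MeasurableSet S :=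
      (measurable_pi_lambda _ fun k => Complex.measurable_im.comp (measurable_pi_apply k)) hboxm
    calc ∫⁻ z in Set.univ.pi fun k => Metric.ball (z0 k) (δ / 2), f z
        ≤ ∫⁻ z in S, f z := by
          refine lintegral_mono_set fun z hz k _ => ?_
          have h2 := abs_lt.1 (him k (z k) (hz k trivial))
          constructor <;> simp only <;> linarith [h2.1, h2.2]
      _ = ∫⁻ p : (Fin d → ℝ) × (Fin d → ℝ), S.indicator f (complexPoint p.1 p.2) := by
          rw [← lintegral_indicator hSm,
            measurePreserving_complexPoint.lintegral_comp (hfm.indicator hSm)]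
      _ = ∫⁻ y, ∫⁻ x, S.indicator f (complexPoint x y) := by
          rw [Measure.volume_eq_prod]
          exact lintegral_prod_symm' _ ((hfm.indicator hSm).comp
            measurePreserving_complexPoint.measurable)
      _ ≤ ∫⁻ y in box, C := by
          rw [← lintegral_indicator hboxm]
          refine lintegral_mono fun y => ?_
          by_cases hy : y ∈ box
          · rw [Set.indicator_of_mem hy]
            have hyδ : ∀ k, δ / 2 ≤ y k := fun k => by linarith [(hy k trivial).1, hz0 k]
            refine le_trans (lintegral_mono fun x => ?_)
              (hFC y fun k => lt_of_lt_of_le (by positivity) (hyδ k))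
            refine (Set.indicator_le_self _ _ _).trans ?_
            simp only [hf]
            rw [hHF _ fun k => by rw [im_complexPoint]; exact hyδ k, enorm_pow]
          · rw [Set.indicator_of_notMem hy]
            refine le_of_eq ?_
            rw [← lintegral_zero (μ := (volume : Measure (Fin d → ℝ)))]
            refine lintegral_congr fun x => Set.indicator_of_notMem ?_ _
            simpa only [hS, Set.mem_ofPred_eq, im_complexPoint] using hy
      _ = B := by
          rw [setLIntegral_const, hbox, Real.volume_pi_Ioo, hB, mul_comm]
          congr 1
          simp only [show ∀ k, (z0 k).im + δ / 2 - ((z0 k).im - δ / 2) = δ by intro k; ring,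
            Finset.prod_const, Finset.card_univ, Fintype.card_fin]
  have hBt : B / κ ^ d ≠ ∞ :=
    ENNReal.div_ne_top (ENNReal.mul_ne_top (ENNReal.pow_ne_top ENNReal.ofReal_ne_top) hC)
      (pow_ne_zero d hκ0)
  refine ⟨Real.sqrt (B / κ ^ d).toReal, fun z hz => ?_⟩
  have h1 : f z ≤ B / κ ^ d := by
    rw [ENNReal.le_div_iff_mul_le (Or.inl (pow_ne_zero d hκ0))
      (Or.inl (ENNReal.pow_ne_top (by simp [hκ, ENNReal.mul_eq_top]))), mul_comm]
    exact main z hz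
  have h2 := (ENNReal.toReal_le_toReal (by simp [hf]) hBt).2 h1
  refine Real.le_sqrt_of_sq_le ?_
  rw [← hHF z fun k => by linarith [hz k]]
  simpa [hf] using h2

theorem exists_pos_forall_le {y : Fin d → ℝ} (hy : ∀ k, 0 < y k) : ∃ δ > 0, ∀ k, δ ≤ y k := by
  have h : ∀ᶠ δ in 𝓝[>] (0 : ℝ), ∀ k, δ ≤ y k :=
    eventually_all.2 fun k => ((eventually_lt_nhds (hy k)).filter_mono nhdsWithin_le_nhds).mono
      fun _ h => h.le
  obtain ⟨δ, h1, h2⟩ := (h.and self_mem_nhdsWithin).exists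
  exact ⟨δ, h2, h1⟩

/-- A locally bounded separately holomorphic function is continuous. -/
theorem SeparatelyHolomorphic.continuousOn {F : (Fin d → ℂ) → ℂ} (hF : SeparatelyHolomorphic F)
    (hb : ∀ δ > 0, ∃ M : ℝ, ∀ z : Fin d → ℂ, (∀ k, δ ≤ (z k).im) → ‖F z‖ ≤ M) :
    ContinuousOn F (upperPolyplane d) := by
  intro z0 hz0
  refine ContinuousAt.continuousWithinAt ?_
  obtain ⟨η, hη, hηz⟩ := exists_pos_forall_le (y := fun k => (z0 k).im) hz0
  -- Three levels are needed: imaginary parts at least `3δ` at `z0`, at least `2δ` at nearby points,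
  -- and at least `δ` on discs of radius `δ` about those.
  set δ := η / 3 with hδ
  have hδ0 : 0 < δ := by positivity
  obtain ⟨M, hM⟩ := hb δ hδ0
  -- By the Schwarz lemma on a disc of radius `δ`, where `F` varies by at most `2M`. The Lipschitz
  -- constant does not depend on the other variables.
  have hlip : ∀ (z : Fin d → ℂ) (k : Fin d) (w : ℂ), (∀ j, 2 * δ ≤ (z j).im) →
      ‖w - z k‖ < δ → ‖F (Function.update z k w) - F z‖ ≤ 2 * M / δ * ‖w - z k‖ := by
    intro z k w hz hw
    have him : ∀ v ∈ Metric.ball (z k) δ, δ ≤ v.im := by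
      intro v hv
      have h1 := (Complex.abs_im_le_norm (v - z k)).trans (mem_ball_iff_norm.1 hv).le
      rw [Complex.sub_im] at h1
      linarith [(abs_le.1 h1).1, hz k]
    have hup : z ∈ upperPolyplane d := fun j => lt_of_lt_of_le (by positivity) (hz j)
    have hd1 : DifferentiableOn ℂ (fun v => F (Function.update z k v)) (Metric.ball (z k) δ) :=
      fun v hv => (hF.differentiableAt_update hup k
        (hδ0.trans_le (him v hv))).differentiableWithinAt
    have hbd : ∀ v ∈ Metric.ball (z k) δ, ‖F (Function.update z k v)‖ ≤ M := by
      intro v hv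
      refine hM _ fun j => ?_
      by_cases hj : j = k
      · subst hj
        simpa using him v hv
      · rw [Function.update_of_ne hj]
        linarith [hz j]
    have hzb := hbd (z k) (Metric.mem_ball_self hδ0)
    have h := Complex.dist_le_div_mul_dist_of_mapsTo_ball (R₂ := 2 * M) hd1 (fun v hv => ?_)
      (mem_ball_iff_norm.2 hw)
    · simpa only [Function.update_eq_self, dist_eq_norm] using h
    · rw [Metric.mem_closedBall, dist_eq_norm]
      refine (norm_sub_le _ _).trans ?_
      linarith [hbd v hv]
  -- Telescoping: the coordinates of `z0` are replaced by those of `z` one at a time.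
  have htel : ∀ z : Fin d → ℂ, ‖z - z0‖ < δ → ∀ s : Finset (Fin d),
      ‖F (s.piecewise z z0) - F z0‖ ≤ 2 * M / δ * ∑ k ∈ s, ‖z k - z0 k‖ := by
    intro z hz s
    have hzk : ∀ k, ‖z k - z0 k‖ < δ := fun k => (norm_le_pi_norm (z - z0) k).trans_lt hz
    induction s using Finset.induction_on with
    | empty => simp
    | insert i s hi ih =>
      rw [Finset.piecewise_insert, Finset.sum_insert hi, mul_add]
      have h1 := hlip (s.piecewise z z0) i (z i) (fun j => ?_) ?_
      · rw [Finset.piecewise_eq_of_notMem _ _ _ hi] at h1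
        refine (norm_sub_le_norm_sub_add_norm_sub _ (F (s.piecewise z z0)) _).trans ?_
        linarith
      · by_cases hj : j ∈ s
        · rw [Finset.piecewise_eq_of_mem _ _ _ hj]
          have h2 := (Complex.abs_im_le_norm (z j - z0 j)).trans (hzk j).le
          rw [Complex.sub_im] at h2
          linarith [(abs_le.1 h2).1, hηz j]
        · rw [Finset.piecewise_eq_of_notMem _ _ _ hj]
          linarith [hηz j]
      · rw [Finset.piecewise_eq_of_notMem _ _ _ hi]
        exact hzk i
  rw [ContinuousAt, tendsto_iff_norm_sub_tendsto_zero]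
  have hlim : Tendsto (fun z : Fin d → ℂ => 2 * M / δ * ∑ k, ‖z k - z0 k‖) (𝓝 z0) (𝓝 0) := by
    have hc : Continuous fun z : Fin d → ℂ => 2 * M / δ * ∑ k, ‖z k - z0 k‖ := by fun_prop
    simpa using hc.tendsto z0
  refine squeeze_zero' (Eventually.of_forall fun _ => norm_nonneg _) ?_ hlim
  filter_upwards [Metric.ball_mem_nhds z0 hδ0] with z hz
  simpa using htel z (mem_ball_iff_norm.1 hz) Finset.univ

end ScheffersAlgebra

/-! ### Contour shifting for rapidly decaying functions -/

theorem integrable_inv_one_add_mul_sq {c : ℝ} (hc : 0 < c) :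
    Integrable fun t : ℝ => (1 + c * t ^ 2)⁻¹ := by
  have h := integrable_inv_one_add_sq.comp_mul_left' (R := Real.sqrt c) (Real.sqrt_pos.2 hc).ne'
  refine h.congr (Eventually.of_forall fun t => ?_)
  simp only [mul_pow, Real.sq_sqrt hc.le]

/-- Shifting a horizontal contour, for a holomorphic function with quadratic decay. -/
theorem integral_horizontal_eq {φ : ℂ → ℂ} {a b c K : ℝ} (hc : 0 < c) (hab : a ≤ b)
    (hd : ∀ w : ℂ, a ≤ w.im → w.im ≤ b → DifferentiableAt ℂ φ w)
    (hb : ∀ t η : ℝ, a ≤ η → η ≤ b → ‖φ (t + η * Complex.I)‖ ≤ K * (1 + c * t ^ 2)⁻¹) :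
    ∫ t : ℝ, φ (t + a * Complex.I) = ∫ t : ℝ, φ (t + b * Complex.I) := by
  have hint : ∀ η, a ≤ η → η ≤ b → Integrable fun t : ℝ => φ (t + η * Complex.I) := by
    intro η h1 h2
    refine ((integrable_inv_one_add_mul_sq hc).const_mul K).mono' ?_
      (Eventually.of_forall fun t => hb t η h1 h2)
    refine Continuous.aestronglyMeasurable (continuous_iff_continuousAt.2 fun t => ?_)
    refine ContinuousAt.comp (g := φ) (hd _ ?_ ?_).continuousAt (by fun_prop) <;> simpa
  have hlim : ∀ η, a ≤ η → η ≤ b → Tendsto (fun T : ℝ => ∫ t in (-T)..T, φ (t + η * Complex.I))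
      atTop (𝓝 (∫ t : ℝ, φ (t + η * Complex.I))) := fun η h1 h2 =>
    intervalIntegral_tendsto_integral (hint η h1 h2) tendsto_neg_atTop_atBot tendsto_id
  have hdecay : Tendsto (fun T : ℝ => K * (1 + c * T ^ 2)⁻¹ * |b - a|) atTop (𝓝 0) := by
    have h1 : Tendsto (fun T : ℝ => 1 + c * T ^ 2) atTop atTop :=
      tendsto_atTop_add_const_left _ _ ((tendsto_pow_atTop two_ne_zero).const_mul_atTop hc)
    simpa using (h1.inv_tendsto_atTop.const_mul K).mul_const |b - a|
  -- The map `s` is `T` or `-T`, so both vertical sides of the rectangle are treated together; only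
  -- `T²` enters the decay bound.
  have hside : ∀ s : ℝ → ℝ, (∀ T, s T ^ 2 = T ^ 2) →
      Tendsto (fun T : ℝ => ∫ η in a..b, φ (s T + η * Complex.I)) atTop (𝓝 0) := by
    intro s hs
    refine squeeze_zero_norm (fun T => ?_) hdecay
    refine intervalIntegral.norm_integral_le_of_norm_le_const fun η hη => ?_
    rw [Set.uIoc_of_le hab] at hη
    rw [← hs]
    exact hb _ _ hη.1.le hη.2
  have hrect : ∀ T : ℝ, (∫ t in (-T)..T, φ (t + a * Complex.I))
      - (∫ t in (-T)..T, φ (t + b * Complex.I))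
      + Complex.I • (∫ η in a..b, φ (T + η * Complex.I))
      - Complex.I • (∫ η in a..b, φ ((-T : ℝ) + η * Complex.I)) = 0 := by
    intro T
    have h := Complex.integral_boundary_rect_eq_zero_of_differentiableOn φ
      (⟨-T, a⟩ : ℂ) (⟨T, b⟩ : ℂ) (fun w hw => ?_)
    · simpa using h
    · rw [Complex.mem_reProdIm] at hw
      have h2 := hw.2
      simp only [Set.uIcc_of_le hab] at h2
      exact (hd w h2.1 h2.2).differentiableWithinAt
  have h1 := (((hlim a le_rfl hab).sub (hlim b hab le_rfl)).add
    ((hside id fun _ => rfl).const_smul Complex.I)).sub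
    ((hside (fun T => -T) fun T => neg_sq T).const_smul Complex.I)
  simp only [id, hrect, smul_zero, add_zero, sub_zero] at h1
  exact (sub_eq_zero.1 (tendsto_nhds_unique h1 tendsto_const_nhds))

namespace ScheffersAlgebra

variable {d : ℕ}

/-- Bounds for a separately holomorphic function with quadratic decay in every real direction. -/
structure RapidlyDecaying (Φ : (Fin d → ℂ) → ℂ) (c K : ℝ) : Prop where
  holo : SeparatelyHolomorphic Φ
  cont : ContinuousOn Φ (upperPolyplane d)
  pos : 0 < c
  nonneg : 0 ≤ K
  bound : ∀ z ∈ upperPolyplane d, ‖Φ z‖ ≤ K * ∏ k, (1 + c * (z k).re ^ 2)⁻¹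

theorem integrable_prod_inv {c : ℝ} (hc : 0 < c) (K : ℝ) :
    Integrable fun x : Fin d → ℝ => K * ∏ k, (1 + c * x k ^ 2)⁻¹ :=
  (Integrable.fintype_prod (f := fun (_ : Fin d) t => (1 + c * t ^ 2)⁻¹)
    fun _ => integrable_inv_one_add_mul_sq hc).const_mul K

theorem complexPoint_mem {y : Fin d → ℝ} (hy : ∀ k, 0 < y k) (x : Fin d → ℝ) :
    complexPoint x y ∈ upperPolyplane d := fun k => by
  rw [im_complexPoint]
  exact hy k

theorem re_complexPoint (x y : Fin d → ℝ) (k : Fin d) : (complexPoint x y k).re = x k := by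
  simp [complexPoint]

theorem continuous_complexPoint (y : Fin d → ℝ) : Continuous fun x => complexPoint x y := by
  unfold complexPoint
  fun_prop

theorem RapidlyDecaying.continuous_slice {Φ : (Fin d → ℂ) → ℂ} {c K : ℝ}
    (hΦ : RapidlyDecaying Φ c K) {y : Fin d → ℝ} (hy : ∀ k, 0 < y k) :
    Continuous fun x => Φ (complexPoint x y) :=
  hΦ.cont.comp_continuous (continuous_complexPoint y) (complexPoint_mem hy)

theorem RapidlyDecaying.norm_slice_le {Φ : (Fin d → ℂ) → ℂ} {c K : ℝ}
    (hΦ : RapidlyDecaying Φ c K) {y : Fin d → ℝ} (hy : ∀ k, 0 < y k) (x : Fin d → ℝ) :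
    ‖Φ (complexPoint x y)‖ ≤ K * ∏ k, (1 + c * x k ^ 2)⁻¹ := by
  simpa only [re_complexPoint] using hΦ.bound _ (complexPoint_mem hy x)

theorem RapidlyDecaying.integrable_slice {Φ : (Fin d → ℂ) → ℂ} {c K : ℝ}
    (hΦ : RapidlyDecaying Φ c K) {y : Fin d → ℝ} (hy : ∀ k, 0 < y k) :
    Integrable fun x => Φ (complexPoint x y) :=
  (integrable_prod_inv hΦ.pos K).mono' (hΦ.continuous_slice hy).aestronglyMeasurable
    (Eventually.of_forall (hΦ.norm_slice_le hy))

/-- The integral of `Φ(z) e^{-i ω · z}` over the plane `Im z = y`. -/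
def planeTransform (Φ : (Fin d → ℂ) → ℂ) (ω y : Fin d → ℝ) : ℂ :=
  ∫ x, Φ (complexPoint x y) * expKernel (-ω) (complexPoint x y)

theorem norm_expKernel_neg (ω x y : Fin d → ℝ) :
    ‖expKernel (-ω) (complexPoint x y)‖ = Real.exp (∑ k, ω k * y k) := by
  rw [norm_expKernel]
  simp [im_complexPoint]

theorem RapidlyDecaying.integrable_mul_expKernel {Φ : (Fin d → ℂ) → ℂ} {c K : ℝ}
    (hΦ : RapidlyDecaying Φ c K) (ω : Fin d → ℝ) {y : Fin d → ℝ} (hy : ∀ k, 0 < y k) :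
    Integrable fun x => Φ (complexPoint x y) * expKernel (-ω) (complexPoint x y) := by
  refine (hΦ.integrable_slice hy).mul_bdd (c := Real.exp (∑ k, ω k * y k)) ?_
    (Eventually.of_forall fun x => (norm_expKernel_neg ω x y).le)
  refine Continuous.aestronglyMeasurable ?_
  unfold expKernel complexPoint
  fun_prop

theorem complexPoint_insertNth {n : ℕ} (k : Fin (n + 1)) (t η : ℝ) (x : Fin n → ℝ)
    (y : Fin (n + 1) → ℝ) :
    complexPoint (k.insertNth t x) (Function.update y k η)
      = Function.update (complexPoint (k.insertNth 0 x) y) k (t + η * Complex.I) := by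
  ext j
  refine Fin.succAboveCases k ?_ (fun i => ?_) j
  · simp [complexPoint]
  · simp [complexPoint, Fin.succAbove_ne]

/-- Fubini isolates the `k`-th variable, and the inner integral is a horizontal contour integral of
a holomorphic function with quadratic decay. -/
theorem RapidlyDecaying.planeTransform_update {Φ : (Fin d → ℂ) → ℂ} {c K : ℝ}
    (hΦ : RapidlyDecaying Φ c K) (ω : Fin d → ℝ) {y : Fin d → ℝ} (hy : ∀ k, 0 < y k) (k : Fin d)
    {a b : ℝ} (ha : 0 < a) (hab : a ≤ b) :
    planeTransform Φ ω (Function.update y k a) = planeTransform Φ ω (Function.update y k b) := by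
  obtain _ | n := d
  · exact k.elim0
  have hupd : ∀ η, 0 < η → ∀ j, 0 < Function.update y k η j := by
    intro η hη j
    by_cases hj : j = k
    · subst hj
      simpa using hη
    · rw [Function.update_of_ne hj]
      exact hy j
  have hmp := (volume_preserving_piFinSuccAbove (fun _ : Fin (n + 1) => ℝ) k).symm
  set G : (Fin (n + 1) → ℂ) → ℂ := fun z => Φ z * expKernel (-ω) z with hG
  have hfub : ∀ η, 0 < η → planeTransform Φ ω (Function.update y k η)
      = ∫ x : Fin n → ℝ, ∫ t : ℝ,
        G (Function.update (complexPoint (k.insertNth 0 x) y) k (t + η * Complex.I)) := by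
    intro η hη
    have hi := hΦ.integrable_mul_expKernel ω (hupd η hη)
    rw [planeTransform, ← hmp.integral_comp
      (MeasurableEquiv.piFinSuccAbove (fun _ => ℝ) k).symm.measurableEmbedding,
      Measure.volume_eq_prod, integral_prod_symm _ ?_]
    · refine integral_congr_ae (Eventually.of_forall fun x => ?_)
      refine integral_congr_ae (Eventually.of_forall fun t => ?_)
      simp only [← complexPoint_insertNth]
      rfl
    · exact (hmp.integrable_comp_emb
        (MeasurableEquiv.piFinSuccAbove (fun _ => ℝ) k).symm.measurableEmbedding).2 hi
  rw [hfub a ha, hfub b (ha.trans_le hab)]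
  refine integral_congr_ae (Eventually.of_forall fun x => ?_)
  have hz : complexPoint (k.insertNth 0 x) y ∈ upperPolyplane (n + 1) := complexPoint_mem hy _
  -- The modulus of the kernel depends only on the height, so it is bounded on the whole strip by
  -- compactness of `[a, b]`.
  obtain ⟨A, hA⟩ : ∃ A : ℝ, ∀ t η : ℝ, a ≤ η → η ≤ b → ‖expKernel (-ω)
      (Function.update (complexPoint (k.insertNth 0 x) y) k (t + η * Complex.I))‖ ≤ A := by
    have hcont : Continuous fun η => Real.exp (∑ j, ω j * Function.update y k η j) := by
      fun_prop
    obtain ⟨A, hA⟩ := isCompact_Icc.exists_bound_of_continuousOn (s := Set.Icc a b) hcont.continuousOn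
    refine ⟨A, fun t η h1 h2 => ?_⟩
    rw [← complexPoint_insertNth, norm_expKernel_neg]
    exact (le_abs_self _).trans (hA η ⟨h1, h2⟩)
  refine integral_horizontal_eq (K := K * A) hΦ.pos hab
    (φ := fun w => G (Function.update (complexPoint (k.insertNth 0 x) y) k w))
    (fun w h1 _ => ?_) fun t η h1 h2 => ?_
  · exact (hΦ.holo.differentiableAt_update hz k (ha.trans_le h1)).mul
      (hasDerivAt_expKernel_update _ _ _ _).differentiableAt
  · have hb := hΦ.norm_slice_le (hupd η (ha.trans_le h1)) (k.insertNth t x)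
    rw [complexPoint_insertNth, ← Finset.mul_prod_erase _ _ (Finset.mem_univ k)] at hb
    have hle : ∏ j ∈ Finset.univ.erase k, (1 + c * (k.insertNth t x : Fin (n + 1) → ℝ) j ^ 2)⁻¹
        ≤ 1 := Finset.prod_le_one (fun j _ => by have := hΦ.pos; positivity) fun j _ =>
      inv_le_one_of_one_le₀ (by have := hΦ.pos; nlinarith [mul_nonneg this.le (sq_nonneg
        ((k.insertNth t x : Fin (n + 1) → ℝ) j))])
    rw [Fin.insertNth_apply_same] at hb
    have hK := hΦ.nonneg
    have hpos : 0 ≤ (1 + c * t ^ 2)⁻¹ := by have := hΦ.pos; positivity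
    simp only [hG, norm_mul]
    calc _ ≤ (K * (1 + c * t ^ 2)⁻¹) * A := by
          refine mul_le_mul (hb.trans ?_) (hA t η h1 h2) (norm_nonneg _) (by positivity)
          exact mul_le_mul_of_nonneg_left (mul_le_of_le_one_right hpos hle) hK
      _ = K * A * (1 + c * t ^ 2)⁻¹ := by ring

/-- The heights are exchanged one coordinate at a time, with the contour shift read in whichever
direction the inequality allows. -/
theorem RapidlyDecaying.planeTransform_eq {Φ : (Fin d → ℂ) → ℂ} {c K : ℝ}
    (hΦ : RapidlyDecaying Φ c K) (ω : Fin d → ℝ) {y y' : Fin d → ℝ} (hy : ∀ k, 0 < y k)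
    (hy' : ∀ k, 0 < y' k) : planeTransform Φ ω y = planeTransform Φ ω y' := by
  have key : ∀ s : Finset (Fin d),
      planeTransform Φ ω (s.piecewise y' y) = planeTransform Φ ω y := by
    intro s
    induction s using Finset.induction_on with
    | empty => simp
    | insert i s hi ih =>
      have hp : ∀ k, 0 < s.piecewise y' y k := by
        intro k
        by_cases hk : k ∈ s <;> simp [hk, hy, hy']
      rw [Finset.piecewise_insert, ← ih]
      conv_rhs => rw [← Function.update_eq_self i (s.piecewise y' y)]
      rcases le_total (y' i) (s.piecewise y' y i) with h | h
      · exact hΦ.planeTransform_update ω hp i (hy' i) h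
      · exact (hΦ.planeTransform_update ω hp i (hp i) h).symm
  simpa using (key Finset.univ).symm

end ScheffersAlgebra

/-! ### Weak limits and the rapidly decaying case of Paley–Wiener -/

/-- A weak sequential limit point of a bounded sequence in a Hilbert space. -/
theorem exists_weak_limit {H : Type*} [NormedAddCommGroup H] [InnerProductSpace ℂ H]
    [CompleteSpace H] {u : ℕ → H} {B : ℝ} (hu : ∀ n, ‖u n‖ ≤ B) :
    ∃ g : H, ∀ (e : H) (L : ℂ), Tendsto (fun n => inner ℂ (u n) e) atTop (𝓝 L) →
      inner ℂ g e = L := by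
  -- Banach–Alaoglu yields a weak-* cluster point. Only pairings already known to converge are
  -- evaluated on it, so no subsequence has to be extracted.
  have hK := WeakDual.isCompact_closedBall (𝕜 := ℂ) (E := H) 0 B
  let v : ℕ → WeakDual ℂ H := fun n => StrongDual.toWeakDual (InnerProductSpace.toDual ℂ H (u n))
  have hv : ∀ n, v n ∈ WeakDual.toStrongDual ⁻¹' Metric.closedBall (0 : StrongDual ℂ H) B := by
    intro n
    simpa [v] using hu n
  obtain ⟨x, -, hx⟩ := hK.exists_mapClusterPt (f := atTop) (u := v)
    (le_principal_iff.2 (mem_map.2 (Eventually.of_forall hv)))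
  refine ⟨(InnerProductSpace.toDual ℂ H).symm (WeakDual.toStrongDual x), fun e L hL => ?_⟩
  rw [InnerProductSpace.toDual_symm_apply]
  have h1 : MapClusterPt (x e) atTop fun n => v n e :=
    hx.continuousAt_comp (WeakDual.eval_continuous e).continuousAt
  have h2 : ClusterPt (x e) (𝓝 L) := ClusterPt.mono h1 hL
  exact eq_of_nhds_neBot h2

namespace ScheffersAlgebra

variable {d : ℕ}

theorem planeTransform_eq_mul (Φ : (Fin d → ℂ) → ℂ) (ω y : Fin d → ℝ) :
    planeTransform Φ ω y = (Real.exp (∑ k, ω k * y k) : ℝ)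
      * fourierLaplace (fun x => Φ (complexPoint x y)) (realPoint (-ω)) := by
  rw [planeTransform, fourierLaplace, ← integral_const_mul]
  refine integral_congr_ae (Eventually.of_forall fun x => ?_)
  have h1 : expKernel x (realPoint (-ω)) = expKernel (-ω) (realPoint x) := by
    simp only [expKernel, realPoint, Pi.neg_apply]
    congr 2
    refine Finset.sum_congr rfl fun k _ => ?_
    push_cast
    ring
  simp only [h1, expKernel_complexPoint, Pi.neg_apply, neg_mul, Finset.sum_neg_distrib, neg_neg]
  ring

/-- The damping cancels the factor `e^{ω · y}` coming from the height, which leaves the plain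
Fourier integral of the slice at height `y`. -/
theorem damp_planeTransform {Φ : (Fin d → ℂ) → ℂ} {y : Fin d → ℝ} {g : (Fin d → ℝ) → ℂ}
    (hg : ∀ ω, g ω = planeTransform Φ ω y) (ω : Fin d → ℝ) :
    damp g y ω = fourierLaplace (fun x => Φ (complexPoint x y)) (realPoint (-ω)) := by
  rw [damp, hg, planeTransform_eq_mul, mul_right_comm, ← Complex.ofReal_mul, ← Real.exp_add,
    add_neg_cancel, Real.exp_zero, Complex.ofReal_one, one_mul]

theorem RapidlyDecaying.norm_planeTransform_le {Φ : (Fin d → ℂ) → ℂ} {c K : ℝ}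
    (hΦ : RapidlyDecaying Φ c K) (ω : Fin d → ℝ) {y : Fin d → ℝ} (hy : ∀ k, 0 < y k) :
    ‖planeTransform Φ ω y‖
      ≤ Real.exp (∑ k, ω k * y k) * ∫ x : Fin d → ℝ, K * ∏ k, (1 + c * x k ^ 2)⁻¹ := by
  rw [planeTransform, ← integral_const_mul]
  refine norm_integral_le_of_norm_le ((integrable_prod_inv hΦ.pos K).const_mul _)
    (Eventually.of_forall fun x => ?_)
  rw [norm_mul, norm_expKernel_neg, mul_comm]
  exact mul_le_mul_of_nonneg_left (hΦ.norm_slice_le hy x) (Real.exp_pos _).le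

theorem sum_mul_update (ω y : Fin d → ℝ) (k : Fin d) (s : ℝ) :
    ∑ j, ω j * Function.update y k s j = ω k * s + ∑ j ∈ Finset.univ.erase k, ω j * y j := by
  rw [← Finset.add_sum_erase _ _ (Finset.mem_univ k), Function.update_self]
  congr 1
  refine Finset.sum_congr rfl fun j hj => ?_
  rw [Function.update_of_ne (Finset.ne_of_mem_erase hj)]

/-- If `ω_k < 0`, the value is unchanged when the `k`-th height `s` goes to infinity, while its
bound contains `e^{ω_k s} → 0`. -/
theorem RapidlyDecaying.planeTransform_eq_zero {Φ : (Fin d → ℂ) → ℂ} {c K : ℝ}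
    (hΦ : RapidlyDecaying Φ c K) {ω : Fin d → ℝ} (hω : ω ∉ Set.Ici (0 : Fin d → ℝ)) :
    planeTransform Φ ω 1 = 0 := by
  obtain ⟨k, hk⟩ : ∃ k, ω k < 0 := by
    by_contra! h
    exact hω h
  have hy1 : ∀ j, 0 < (1 : Fin d → ℝ) j := fun _ => one_pos
  set A := ∑ j ∈ Finset.univ.erase k, ω j * (1 : Fin d → ℝ) j
  set J := ∫ x : Fin d → ℝ, K * ∏ k, (1 + c * x k ^ 2)⁻¹
  have hb : ∀ᶠ s : ℝ in atTop, ‖planeTransform Φ ω 1‖ ≤ Real.exp (ω k * s + A) * J := by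
    filter_upwards [eventually_gt_atTop 0] with s hs
    have hp : ∀ j, 0 < Function.update (1 : Fin d → ℝ) k s j := by
      intro j
      by_cases hj : j = k
      · subst hj
        simpa using hs
      · rw [Function.update_of_ne hj]
        exact one_pos
    rw [hΦ.planeTransform_eq ω hy1 hp, ← sum_mul_update]
    exact hΦ.norm_planeTransform_le ω hp
  have hlim : Tendsto (fun s : ℝ => Real.exp (ω k * s + A) * J) atTop (𝓝 0) := by
    have h1 : Tendsto (fun s : ℝ => ω k * s + A) atTop atBot :=
      tendsto_atBot_add_const_right _ _ (tendsto_id.const_mul_atTop_of_neg hk)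
    simpa using (Real.tendsto_exp_atBot.comp h1).mul_const J
  exact norm_le_zero_iff.1 (ge_of_tendsto hlim hb)

/-- The Paley–Wiener theorem for rapidly decaying functions. -/
theorem RapidlyDecaying.exists_orthantL2 {Φ : (Fin d → ℂ) → ℂ} {c K : ℝ}
    (hΦ : RapidlyDecaying Φ c K) {C : ℝ≥0∞} (hC : C ≠ ∞)
    (hΦC : ∀ y : Fin d → ℝ, (∀ k, 0 < y k) → ∫⁻ x, ‖Φ (complexPoint x y)‖ₑ ^ 2 ≤ C) :
    ∃ g : (Fin d → ℝ) → ℂ, OrthantL2 g ∧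
      ∫⁻ ω, ‖g ω‖ₑ ^ 2 ≤ ENNReal.ofReal ((2 * Real.pi) ^ d) * C ∧
      ∀ z ∈ upperPolyplane d, fourierLaplace g z = ((2 * Real.pi) ^ d : ℝ) • Φ z := by
  set g : (Fin d → ℝ) → ℂ := fun ω => planeTransform Φ ω 1 with hg
  have hgy : ∀ {y : Fin d → ℝ}, (∀ k, 0 < y k) → ∀ ω, damp g y ω
      = fourierLaplace (fun x => Φ (complexPoint x y)) (realPoint (-ω)) := by
    intro y hy
    exact damp_planeTransform fun ω => hΦ.planeTransform_eq ω (fun _ => one_pos) hy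
  have hcont : Continuous g := by
    have h1 : g = fun ω => (Real.exp (∑ k, ω k * (1 : Fin d → ℝ) k) : ℝ)
        * fourierLaplace (fun x => Φ (complexPoint x 1)) (realPoint (-ω)) :=
      funext fun ω => planeTransform_eq_mul Φ ω 1
    rw [h1]
    exact (by fun_prop : Continuous fun ω : Fin d → ℝ =>
      ((Real.exp (∑ k, ω k * (1 : Fin d → ℝ) k) : ℝ) : ℂ)).mul
      ((continuous_fourierLaplace_realPoint
        (hΦ.integrable_slice fun _ => one_pos)).comp continuous_neg)
  have hL2 : ∀ {y : Fin d → ℝ}, (∀ k, 0 < y k) →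
      ∫⁻ ω, ‖damp g y ω‖ₑ ^ 2 ≤ ENNReal.ofReal ((2 * Real.pi) ^ d) * C := by
    intro y hy
    simp only [hgy hy]
    rw [lintegral_neg_eq_self
      (fun ω => ‖fourierLaplace (fun x => Φ (complexPoint x y)) (realPoint ω)‖ₑ ^ 2),
      plancherel (hΦ.integrable_slice hy) (memLp_two_of_lintegral_lt_top
        (hΦ.continuous_slice hy).aestronglyMeasurable ((hΦC y hy).trans_lt hC.lt_top))]
    exact mul_le_mul_right (hΦC y hy) _
  have hpos : ∀ n : ℕ, ∀ k, 0 < (fun _ : Fin d => 1 / ((n : ℝ) + 1)) k := fun n k => by positivity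
  -- Fatou's lemma as the heights `1/(n+1)` decrease to zero; the damped functions obey the bound
  -- uniformly.
  have hbd : ∫⁻ ω, ‖g ω‖ₑ ^ 2 ≤ ENNReal.ofReal ((2 * Real.pi) ^ d) * C := by
    have hlim : ∀ ω, Tendsto (fun n : ℕ => ‖damp g (fun _ : Fin d => 1 / ((n : ℝ) + 1)) ω‖ₑ ^ 2)
        atTop (𝓝 (‖g ω‖ₑ ^ 2)) := by
      intro ω
      have hc : Continuous fun y => damp g y ω := by
        unfold damp
        fun_prop
      have hy0 : Tendsto (fun n : ℕ => fun _ : Fin d => 1 / ((n : ℝ) + 1)) atTop (𝓝 0) :=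
        tendsto_pi_nhds.2 fun _ => tendsto_one_div_add_atTop_nhds_zero_nat
      have h1 := (hc.tendsto 0).comp hy0
      have h2 : damp g 0 ω = g ω := by simp [damp]
      rw [h2] at h1
      exact ((ENNReal.continuous_pow 2).tendsto _).comp h1.enorm
    calc ∫⁻ ω, ‖g ω‖ₑ ^ 2
        = ∫⁻ ω, liminf (fun n : ℕ => ‖damp g (fun _ : Fin d => 1 / ((n : ℝ) + 1)) ω‖ₑ ^ 2) atTop :=
          lintegral_congr fun ω => (hlim ω).liminf_eq.symm
      _ ≤ liminf (fun n : ℕ => ∫⁻ ω, ‖damp g (fun _ : Fin d => 1 / ((n : ℝ) + 1)) ω‖ₑ ^ 2) atTop :=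
          lintegral_liminf_le' fun n => (aestronglyMeasurable_damp
            hcont.aestronglyMeasurable _).enorm.pow_const 2
      _ ≤ _ := liminf_le_of_frequently_le' (Frequently.of_forall fun n => hL2 (hpos n))
  have hgO : OrthantL2 g := ⟨memLp_two_of_lintegral_lt_top hcont.aestronglyMeasurable
    (hbd.trans_lt (ENNReal.mul_lt_top ENNReal.ofReal_lt_top hC.lt_top)),
    Eventually.of_forall fun ω hω => hΦ.planeTransform_eq_zero hω⟩
  refine ⟨g, hgO, hbd, fun z hz => ?_⟩
  have hzp : z = complexPoint (fun k => (z k).re) (fun k => (z k).im) := by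
    ext k
    simp [complexPoint]
  -- Since `g` is square integrable and supported in the orthant, its damped version is integrable,
  -- as Fourier inversion requires.
  have hint := hgO.integrable_damp (y := fun k => (z k).im) hz
  have e : damp g (fun k => (z k).im)
      = fun ω => fourierLaplace (fun x => Φ (complexPoint x fun k => (z k).im)) (realPoint (-ω)) :=
    funext (hgy hz)
  rw [hzp, fourierLaplace_complexPoint, e,
    fourierLaplace_inversion (hΦ.continuous_slice hz) (hΦ.integrable_slice hz) (e ▸ hint)]

/-! ### Regularisation and the Paley–Wiener theorem on the polyplane -/

/-- The regularisation `F(z + iε) ∏ (1 - iε z_k)⁻²`. -/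
def regularize (F : (Fin d → ℂ) → ℂ) (ε : ℝ) (z : Fin d → ℂ) : ℂ :=
  F (fun k => z k + ε * Complex.I) * ∏ k, ((1 - Complex.I * ε * z k) ^ 2)⁻¹

/-- `|1 - iεw|² = (1 + ε Im w)² + (ε Re w)²`, and the first square is at least `1`. -/
theorem norm_inv_sq_le {ε : ℝ} (hε : 0 < ε) {w : ℂ} (hw : 0 < w.im) :
    ‖((1 - Complex.I * ε * w) ^ 2)⁻¹‖ ≤ (1 + ε ^ 2 * w.re ^ 2)⁻¹ := by
  rw [norm_inv, norm_pow]
  refine inv_anti₀ (by positivity) ?_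
  rw [← Complex.normSq_eq_norm_sq, Complex.normSq_apply]
  have h1 : (1 - Complex.I * ε * w).re = 1 + ε * w.im := by
    simp [Complex.mul_re, Complex.mul_im]
  have h2 : (1 - Complex.I * ε * w).im = -(ε * w.re) := by
    simp [Complex.mul_re, Complex.mul_im]
  rw [h1, h2]
  nlinarith [mul_pos hε hw, sq_nonneg (ε * w.im)]

theorem one_sub_ne_zero {ε : ℝ} (hε : 0 < ε) {w : ℂ} (hw : 0 < w.im) :
    (1 - Complex.I * ε * w) ≠ 0 := by
  intro h
  have h1 : (1 - Complex.I * ε * w).re = 1 + ε * w.im := by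
    simp [Complex.mul_re, Complex.mul_im]
  rw [h, Complex.zero_re] at h1
  nlinarith [mul_pos hε hw]

theorem add_mem_upperPolyplane {ε : ℝ} (hε : 0 ≤ ε) {z : Fin d → ℂ} (hz : z ∈ upperPolyplane d) :
    (fun k => z k + ε * Complex.I) ∈ upperPolyplane d := fun k => by
  have := hz k
  simp
  linarith

/-- The shift by `iε` keeps `F` where it is bounded by `M`; the extra factors supply the decay, with
`c = ε²`. -/
theorem SeparatelyHolomorphic.rapidlyDecaying_regularize {F : (Fin d → ℂ) → ℂ}
    (hF : SeparatelyHolomorphic F) (hFc : ContinuousOn F (upperPolyplane d)) {ε M : ℝ}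
    (hε : 0 < ε) (hM : ∀ z : Fin d → ℂ, (∀ k, ε ≤ (z k).im) → ‖F z‖ ≤ M) :
    RapidlyDecaying (regularize F ε) (ε ^ 2) |M| where
  pos := by positivity
  nonneg := abs_nonneg M
  cont := by
    refine ContinuousOn.mul ?_ ?_
    · exact hFc.comp (by fun_prop) fun z hz => add_mem_upperPolyplane hε.le hz
    · refine continuousOn_finsetProd _ fun k _ => ContinuousOn.inv₀ (by fun_prop) fun z hz => ?_
      exact pow_ne_zero 2 (one_sub_ne_zero hε (hz k))
  holo := by
    intro z hz k
    have e : ∀ w, (fun j => Function.update z k w j + ε * Complex.I)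
        = Function.update (fun j => z j + ε * Complex.I) k (w + ε * Complex.I) := by
      intro w
      ext j
      by_cases hj : j = k
      · subst hj
        simp
      · simp [hj]
    unfold regularize
    simp only [e]
    refine DifferentiableAt.mul ?_ ?_
    · have h1 := hF _ (add_mem_upperPolyplane hε.le hz) k
      exact DifferentiableAt.comp (g := fun w => F (Function.update (fun j => z j + ε * Complex.I) k w))
        (f := fun w => w + ε * Complex.I) (z k) h1 (by fun_prop)
    · refine DifferentiableAt.fun_finsetProd fun j _ => DifferentiableAt.inv ?_ ?_
      · have h2 : DifferentiableAt ℂ (fun w => Function.update z k w j) (z k) :=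
          differentiableAt_pi.1 (hasDerivAt_update z k (z k)).differentiableAt j
        fun_prop
      · simp only [Function.update_eq_self]
        exact pow_ne_zero 2 (one_sub_ne_zero hε (hz j))
  bound := by
    intro z hz
    rw [regularize, norm_mul, norm_prod]
    refine mul_le_mul ((hM _ fun k => ?_).trans (le_abs_self M))
      (Finset.prod_le_prod (fun k _ => norm_nonneg _) fun k _ => norm_inv_sq_le hε (hz k))
      (Finset.prod_nonneg fun k _ => norm_nonneg _) (abs_nonneg M)
    have := hz k
    simp
    linarith

theorem norm_regularize_le (F : (Fin d → ℂ) → ℂ) {ε : ℝ} (hε : 0 < ε) {z : Fin d → ℂ}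
    (hz : z ∈ upperPolyplane d) : ‖regularize F ε z‖ ≤ ‖F fun k => z k + ε * Complex.I‖ := by
  rw [regularize, norm_mul, norm_prod]
  refine mul_le_of_le_one_right (norm_nonneg _) (Finset.prod_le_one (fun _ _ => norm_nonneg _)
    fun k _ => (norm_inv_sq_le hε (hz k)).trans (inv_le_one_of_one_le₀ ?_))
  nlinarith [mul_nonneg (sq_nonneg ε) (sq_nonneg (z k).re)]

theorem tendsto_regularize {F : (Fin d → ℂ) → ℂ} (hFc : ContinuousOn F (upperPolyplane d))
    {z : Fin d → ℂ} (hz : z ∈ upperPolyplane d) :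
    Tendsto (fun n : ℕ => regularize F (1 / ((n : ℝ) + 1)) z) atTop (𝓝 (F z)) := by
  have ho : IsOpen (upperPolyplane d) := by
    simp only [upperPolyplane, Set.ofPred_forall]
    exact isOpen_iInter_of_finite fun k =>
      isOpen_lt continuous_const (Complex.continuous_im.comp (continuous_apply k))
  have hFz : ContinuousAt F z := hFc.continuousAt (ho.mem_nhds hz)
  have hc : ContinuousAt (fun ε : ℝ => regularize F ε z) 0 := by
    unfold regularize
    refine ContinuousAt.mul ?_ ?_
    · refine ContinuousAt.comp (g := F) (f := fun ε : ℝ => fun k => z k + ε * Complex.I) ?_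
        (by fun_prop)
      simpa using hFz
    · refine tendsto_finsetProd _ fun k _ => ContinuousAt.inv₀ (by fun_prop) (by simp)
  have h := hc.tendsto.comp tendsto_one_div_add_atTop_nhds_zero_nat
  simpa [Function.comp_def, regularize] using h

/-- The conjugate exponential kernel, cut off to the orthant. -/
def conjKernel (z : Fin d → ℂ) : (Fin d → ℝ) → ℂ :=
  (Set.Ici (0 : Fin d → ℝ)).indicator fun ω => (starRingEnd ℂ) (expKernel ω z)

theorem memLp_conjKernel {z : Fin d → ℂ} (hz : z ∈ upperPolyplane d) :
    MemLp (conjKernel z) 2 volume := by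
  refine (memLp_orthantExp (y := fun k => (z k).im) hz).mono
    ((Complex.continuous_conj.comp (continuous_expKernel z)).aestronglyMeasurable.indicator
      measurableSet_Ici) (Eventually.of_forall fun ω => ?_)
  rw [conjKernel]
  by_cases hm : ω ∈ Set.Ici (0 : Fin d → ℝ)
  · rw [Set.indicator_of_mem hm, orthantExp_of_mem hm, RCLike.norm_conj, norm_expKernel,
      Real.norm_of_nonneg (Real.exp_pos _).le]
  · rw [Set.indicator_of_notMem hm, norm_zero]
    exact norm_nonneg _

/-- Evaluation of the transform at `z` is a continuous functional on `L²`, so weak limits preserve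
it. -/
theorem inner_conjKernel {z : Fin d → ℂ} (hz : z ∈ upperPolyplane d)
    (u : Lp ℂ 2 (volume : Measure (Fin d → ℝ))) :
    inner ℂ u ((memLp_conjKernel hz).toLp _)
      = (starRingEnd ℂ) (fourierLaplace ((Set.Ici (0 : Fin d → ℝ)).indicator u) z) := by
  rw [L2.inner_def, fourierLaplace, ← integral_conj]
  refine integral_congr_ae ?_
  filter_upwards [(memLp_conjKernel hz).coeFn_toLp] with ω hω
  rw [hω, conjKernel, RCLike.inner_apply, map_mul]
  by_cases hm : ω ∈ Set.Ici (0 : Fin d → ℝ)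
  · rw [Set.indicator_of_mem hm, Set.indicator_of_mem hm, mul_comm]
  · rw [Set.indicator_of_notMem hm, Set.indicator_of_notMem hm]
    simp

/-- The **Paley–Wiener theorem** for the product of upper half planes in `ℂ^d`. -/
theorem SeparatelyHolomorphic.exists_orthantL2 {F : (Fin d → ℂ) → ℂ}
    (hF : SeparatelyHolomorphic F) {C : ℝ≥0∞} (hC : C ≠ ∞)
    (hFC : ∀ y : Fin d → ℝ, (∀ k, 0 < y k) → ∫⁻ x, ‖F (complexPoint x y)‖ₑ ^ 2 ≤ C) :
    ∃ g : (Fin d → ℝ) → ℂ, OrthantL2 g ∧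
      ∀ z ∈ upperPolyplane d, fourierLaplace g z = ((2 * Real.pi) ^ d : ℝ) • F z := by
  have hb : ∀ δ > 0, ∃ M : ℝ, ∀ z : Fin d → ℂ, (∀ k, δ ≤ (z k).im) → ‖F z‖ ≤ M :=
    fun δ hδ => hF.exists_bound hC hFC hδ
  have hFc := hF.continuousOn hb
  have hreg : ∀ n : ℕ, ∃ g : (Fin d → ℝ) → ℂ, OrthantL2 g ∧
      ∫⁻ ω, ‖g ω‖ₑ ^ 2 ≤ ENNReal.ofReal ((2 * Real.pi) ^ d) * C ∧
      ∀ z ∈ upperPolyplane d, fourierLaplace g z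
        = ((2 * Real.pi) ^ d : ℝ) • regularize F (1 / ((n : ℝ) + 1)) z := by
    intro n
    have hε : 0 < 1 / ((n : ℝ) + 1) := by positivity
    obtain ⟨M, hM⟩ := hb _ hε
    refine (hF.rapidlyDecaying_regularize hFc hε hM).exists_orthantL2 hC fun y hy => ?_
    refine le_trans (lintegral_mono fun x => ?_)
      (hFC (fun k => y k + 1 / ((n : ℝ) + 1)) fun k => add_pos (hy k) hε)
    refine pow_le_pow_left' (enorm_le_iff_norm_le.2 ?_) 2
    refine (norm_regularize_le F hε (complexPoint_mem hy x)).trans_eq ?_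
    congr 2
    ext k
    simp only [complexPoint]
    push_cast
    ring
  choose g hgO hgB hgF using hreg
  set D := ENNReal.ofReal ((2 * Real.pi) ^ d) * C with hD
  have hDt : D ≠ ∞ := ENNReal.mul_ne_top ENNReal.ofReal_ne_top hC
  let u : ℕ → Lp ℂ 2 (volume : Measure (Fin d → ℝ)) := fun n => (hgO n).1.toLp (g n)
  have hu : ∀ n, ‖u n‖ ≤ Real.sqrt D.toReal := by
    intro n
    rw [Lp.norm_toLp]
    refine Real.le_sqrt_of_sq_le ?_
    rw [← ENNReal.toReal_pow, eLpNorm_two_sq]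
    exact ENNReal.toReal_mono hDt (hgB n)
  obtain ⟨G, hG⟩ := exists_weak_limit hu
  -- Cutting the weak limit to the orthant costs nothing: the test kernels vanish outside it, so the
  -- support of `G` need not be determined.
  set g0 : (Fin d → ℝ) → ℂ := (Set.Ici (0 : Fin d → ℝ)).indicator G with hg0
  have hgO0 : OrthantL2 g0 := ⟨(Lp.memLp G).indicator measurableSet_Ici,
    Eventually.of_forall fun ω hω => Set.indicator_of_notMem hω _⟩
  refine ⟨g0, hgO0, fun z hz => ?_⟩
  have h1 := hG ((memLp_conjKernel hz).toLp _)
    ((starRingEnd ℂ) (((2 * Real.pi) ^ d : ℝ) • F z)) ?_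
  · rw [inner_conjKernel hz] at h1
    exact (starRingEnd ℂ).injective h1
  · have h2 : ∀ n, inner ℂ (u n) ((memLp_conjKernel hz).toLp _)
        = (starRingEnd ℂ) (((2 * Real.pi) ^ d : ℝ) • regularize F (1 / ((n : ℝ) + 1)) z) := by
      intro n
      rw [inner_conjKernel hz, ← hgF n z hz]
      congr 1
      refine integral_congr_ae ?_
      filter_upwards [(hgO n).1.coeFn_toLp, (hgO n).2] with ω hω1 hω2
      by_cases hm : ω ∈ Set.Ici (0 : Fin d → ℝ)
      · rw [Set.indicator_of_mem hm, hω1]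
      · rw [Set.indicator_of_notMem hm, hω2 hm]
    simp only [h2]
    exact (Complex.continuous_conj.tendsto _).comp ((tendsto_regularize hFc hz).const_smul _)

/-! ### Holomorphy, slices and `L²` norms through the characters -/

theorem complexCoord_mem {ζ : TotalSpace d} (hζ : ζ ∈ upperSpace d) (ε : Finset (Fin d)) :
    complexCoord ε ζ ∈ upperPolyplane d := fun k => by
  rw [im_complexCoord]
  exact hζ k

theorem point_mem_upperSpace {y : Fin d → ℝ} (hy : ∀ k, 0 < y k) (x : Fin d → ℝ) :
    point x y ∈ upperSpace d := fun k => by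
  rw [point, coeff_planeMk]
  exact hy k

/-- The point of `𝕊^d` with complex coordinates `z` with respect to the character of `ε`. -/
def coordPoint (ε : Finset (Fin d)) (z : Fin d → ℂ) : TotalSpace d :=
  fun k => planeMk k (flipSign ε k * (z k).re) (z k).im

theorem complexCoord_coordPoint (ε : Finset (Fin d)) (z : Fin d → ℂ) :
    complexCoord ε (coordPoint ε z) = z := by
  ext k
  rw [complexCoord, coordPoint, flipSign_mul_character_planeMk, ← mul_assoc, flipSign_mul_self,
    one_mul, Complex.re_add_im]

theorem coordPoint_complexCoord (ε : Finset (Fin d)) (ζ : TotalSpace d) :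
    coordPoint ε (complexCoord ε ζ) = ζ := by
  ext k : 1
  obtain ⟨a, b, h⟩ := planeMk_surjective k (ζ k)
  rw [coordPoint, complexCoord, h, flipSign_mul_character_planeMk]
  congr 1
  · simp [← mul_assoc, flipSign_mul_self]
  · simp

theorem coordPoint_mem {z : Fin d → ℂ} (hz : z ∈ upperPolyplane d) (ε : Finset (Fin d)) :
    coordPoint ε z ∈ upperSpace d := fun k => by
  rw [coordPoint, coeff_planeMk]
  exact hz k

theorem character_ringInverse (ε : Finset (Fin d)) {w : ScheffersAlgebra d} (hw : IsUnit w) :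
    character ε (Ring.inverse w) = (character ε w)⁻¹ := by
  refine eq_inv_of_mul_eq_one_right ?_
  rw [← map_mul, Ring.mul_inverse_cancel w hw, map_one]

theorem character_ne_zero (ε : Finset (Fin d)) {k : Fin d} {w : plane d k} (hw : w ≠ 0) :
    character ε (w : ScheffersAlgebra d) ≠ 0 :=
  ((isUnit_of_mem_plane w.2 (by simpa using hw)).map (character ε)).ne_zero

/-- The difference quotient of a function on `𝕊^d`, seen through a character, is a slope. -/
theorem character_differenceQuotient {f : TotalSpace d → ScheffersAlgebra d} {ε : Finset (Fin d)}
    {F : (Fin d → ℂ) → ℂ} {ζ : TotalSpace d} {k : Fin d} {z : plane d k} (hz : z ≠ ζ k)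
    (h1 : character ε (f ζ) = F (complexCoord ε ζ))
    (h2 : character ε (f (Function.update ζ k z)) = F (complexCoord ε (Function.update ζ k z))) :
    character ε ((f (Function.update ζ k z) - f ζ) *
      Ring.inverse ((z - ζ k : plane d k) : ScheffersAlgebra d))
      = flipSign ε k * slope (fun w => F (Function.update (complexCoord ε ζ) k w))
        (complexCoord ε ζ k) (flipSign ε k * character ε (z : ScheffersAlgebra d)) := by
  have hne : z - ζ k ≠ 0 := sub_ne_zero.2 hz
  have hu := isUnit_of_mem_plane (z - ζ k).2 fun h => hne (Subtype.ext h)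
  have h3 : ((flipSign ε k : ℂ)) * flipSign ε k = 1 := by
    exact_mod_cast flipSign_mul_self ε k
  have h4 : (flipSign ε k : ℂ)⁻¹ = flipSign ε k := inv_eq_of_mul_eq_one_right h3
  rw [map_mul, character_ringInverse ε hu, map_sub, h1, h2, complexCoord_update, slope_def_field,
    Function.update_eq_self, show complexCoord ε ζ k = flipSign ε k * character ε (ζ k) from rfl,
    ← mul_sub, Submodule.coe_sub, map_sub, div_eq_mul_inv, mul_inv, h4]
  linear_combination (-(F (Function.update (complexCoord ε ζ) k (flipSign ε k * character ε z))
    - F (complexCoord ε ζ)) * (character ε (z : ScheffersAlgebra d) - character ε (ζ k))⁻¹) * h3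

theorem continuous_coe_character (ε : Finset (Fin d)) (k : Fin d) :
    Continuous fun z : plane d k => (flipSign ε k : ℂ) * character ε (z : ScheffersAlgebra d) :=
  continuous_const.mul ((continuous_character ε).comp continuous_subtype_val)

/-- Convergence in `𝕊_d` can be tested on characters, where the difference quotients are complex
slopes; `reconstruct` assembles the derivative. -/
theorem holomorphicOn_of_character {f : TotalSpace d → ScheffersAlgebra d}
    {F : Finset (Fin d) → (Fin d → ℂ) → ℂ} (hF : ∀ ε, SeparatelyHolomorphic (F ε))
    (hf : ∀ ε, ∀ ζ ∈ upperSpace d, character ε (f ζ) = F ε (complexCoord ε ζ)) :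
    HolomorphicOn f (upperSpace d) := by
  intro ζ hζ k
  refine ⟨reconstruct d fun ε => flipSign ε k *
    deriv (fun w => F ε (Function.update (complexCoord ε ζ) k w)) (complexCoord ε ζ k), ?_⟩
  have hup : ∀ᶠ z in 𝓝[≠] (ζ k), z ≠ ζ k ∧ Function.update ζ k z ∈ upperSpace d := by
    refine (eventually_mem_nhdsWithin.mono fun z hz => hz).and (nhdsWithin_le_nhds ?_)
    have hc : Continuous fun z : plane d k => (z : ScheffersAlgebra d).coeff {k} :=
      (continuous_coeff _).comp continuous_subtype_val
    filter_upwards [hc.continuousAt.eventually (lt_mem_nhds (hζ k))] with z hz j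
    by_cases hj : j = k
    · subst hj
      simpa using hz
    · rw [Function.update_of_ne hj]
      exact hζ j
  have key : Tendsto (fun z : plane d k => fun ε => character ε ((f (Function.update ζ k z) - f ζ) *
      Ring.inverse ((z - ζ k : plane d k) : ScheffersAlgebra d))) (𝓝[≠] (ζ k))
      (𝓝 fun ε => flipSign ε k *
        deriv (fun w => F ε (Function.update (complexCoord ε ζ) k w)) (complexCoord ε ζ k)) := by
    refine tendsto_pi_nhds.2 fun ε => ?_
    have hd := hasDerivAt_iff_tendsto_slope.1 (hF ε _ (complexCoord_mem hζ ε) k).hasDerivAt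
    have hv : Tendsto (fun z : plane d k => (flipSign ε k : ℂ) * character ε z) (𝓝[≠] (ζ k))
        (𝓝[≠] (complexCoord ε ζ k)) := by
      refine tendsto_nhdsWithin_iff.2
        ⟨((continuous_coe_character ε k).tendsto (ζ k)).mono_left nhdsWithin_le_nhds, ?_⟩
      filter_upwards [self_mem_nhdsWithin] with z hz h
      have h1 := mul_left_cancel₀ (by exact_mod_cast flipSign_ne_zero ε k) h
      refine character_ne_zero ε (sub_ne_zero.2 hz) ?_
      rw [Submodule.coe_sub, map_sub, h1, sub_self]
    refine ((hd.comp hv).const_mul (flipSign ε k : ℂ)).congr' ?_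
    filter_upwards [hup] with z hz
    rw [character_differenceQuotient hz.1 (hf ε ζ hζ) (hf ε _ hz.2)]
    rfl
  have h2 := ((reconstruct d).continuous.tendsto _).comp key
  simpa only [Function.comp_def, reconstruct_character] using h2

theorem HolomorphicOn.separatelyHolomorphic {f : TotalSpace d → ScheffersAlgebra d}
    (hf : HolomorphicOn f (upperSpace d)) (ε : Finset (Fin d)) :
    SeparatelyHolomorphic fun z => character ε (f (coordPoint ε z)) := by
  intro z hz k
  obtain ⟨L, hL⟩ := hf _ (coordPoint_mem hz ε) k
  -- The inverse of the coordinate on `𝕊(k)`: it lets a complex variable approach its limit inside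
  -- the plane.
  set p : ℂ → plane d k := fun w => planeMk k (flipSign ε k * w.re) w.im with hp
  have hpc : Continuous p := by
    refine Continuous.subtype_mk ?_ _
    fun_prop
  have hpz : p (z k) = coordPoint ε z k := rfl
  have hpi : ∀ w, (flipSign ε k : ℂ) * character ε (p w) = w := by
    intro w
    rw [hp, flipSign_mul_character_planeMk, ← mul_assoc, flipSign_mul_self, one_mul,
      Complex.re_add_im]
  have hpt : Tendsto p (𝓝[≠] (z k)) (𝓝[≠] (coordPoint ε z k)) := by
    refine tendsto_nhdsWithin_iff.2 ⟨(hpc.tendsto (z k)).mono_left nhdsWithin_le_nhds, ?_⟩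
    filter_upwards [self_mem_nhdsWithin] with w hw h
    refine hw ?_
    rw [Set.mem_singleton_iff, ← hpi w, ← hpi (z k), hpz]
    exact congrArg (fun v : plane d k => (flipSign ε k : ℂ) * character ε (v : ScheffersAlgebra d)) h
  have h3 : ((flipSign ε k : ℂ)) * flipSign ε k = 1 := by
    exact_mod_cast flipSign_mul_self ε k
  refine HasDerivAt.differentiableAt (f' := flipSign ε k * character ε L)
    (hasDerivAt_iff_tendsto_slope.2 ?_)
  have h1 := (((continuous_character ε).tendsto L).comp (hL.comp hpt)).const_mul (flipSign ε k : ℂ)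
  refine h1.congr' ?_
  filter_upwards [hpt.eventually self_mem_nhdsWithin] with w hw
  have h4 := character_differenceQuotient (f := f) (ε := ε)
    (F := fun z => character ε (f (coordPoint ε z))) (ζ := coordPoint ε z) (z := p w) hw
    (by rw [coordPoint_complexCoord]) (by rw [coordPoint_complexCoord])
  rw [complexCoord_coordPoint, hpi] at h4
  simp only [Function.comp_apply]
  rw [h4, ← mul_assoc, h3, one_mul]

/-- The reflection of the coordinates in `ε`. -/
def flipEquiv (ε : Finset (Fin d)) : (Fin d → ℝ) ≃ᵐ (Fin d → ℝ) :=
  MeasurableEquiv.ofInvolutive (fun x k => flipSign ε k * x k)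
    (fun x => by
      ext k
      simp only [← mul_assoc, flipSign_mul_self, one_mul])
    (measurable_pi_lambda _ fun k => (measurable_pi_apply k).const_mul _)

theorem flipEquiv_apply (ε : Finset (Fin d)) (x : Fin d → ℝ) (k : Fin d) :
    flipEquiv ε x k = flipSign ε k * x k := rfl

theorem continuous_flipEquiv (ε : Finset (Fin d)) : Continuous (flipEquiv ε) :=
  continuous_pi fun k => continuous_const.mul (continuous_apply k)

theorem measurePreserving_flipEquiv (ε : Finset (Fin d)) :
    MeasurePreserving (flipEquiv ε) volume volume := by
  refine volume_preserving_pi (f := fun k (t : ℝ) => flipSign ε k * t) fun k => ⟨by fun_prop, ?_⟩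
  rw [Real.map_volume_mul_left (flipSign_ne_zero ε k)]
  have : |(flipSign ε k)⁻¹| = 1 := by
    unfold flipSign
    split_ifs <;> norm_num
  rw [this, ENNReal.ofReal_one, one_smul]

theorem lintegral_comp_flipEquiv (ε : Finset (Fin d)) (f : (Fin d → ℝ) → ℝ≥0∞) :
    ∫⁻ x, f (flipEquiv ε x) = ∫⁻ x, f x :=
  (measurePreserving_flipEquiv ε).lintegral_comp_emb (flipEquiv ε).measurableEmbedding f

/-- The price of landing in upper half planes is a reflection of real coordinates, harmless for
integrals over `ℝ^d`. -/
theorem complexCoord_point_eq (ε : Finset (Fin d)) (x y : Fin d → ℝ) :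
    complexCoord ε (point x y) = complexPoint (flipEquiv ε x) y :=
  funext fun k => complexCoord_point ε x y k

theorem complexPoint_zero (x : Fin d → ℝ) : complexPoint x 0 = realPoint x := by
  ext k
  simp [complexPoint, realPoint]

theorem enorm_reconstruct_sq_le (c : Finset (Fin d) → ℂ) :
    ‖reconstruct d c‖ₑ ^ 2 ≤ ‖reconstruct d‖ₑ ^ 2 * ∑ ε, ‖c ε‖ₑ ^ 2 := by
  have h1 : ‖c‖ ^ 2 ≤ ∑ ε, ‖c ε‖ ^ 2 := by
    rw [← Real.le_sqrt (norm_nonneg _) (Finset.sum_nonneg fun _ _ => sq_nonneg _)]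
    refine (pi_norm_le_iff_of_nonneg (Real.sqrt_nonneg _)).2 fun ε => Real.le_sqrt_of_sq_le ?_
    exact Finset.single_le_sum (f := fun ε => ‖c ε‖ ^ 2) (fun _ _ => sq_nonneg _)
      (Finset.mem_univ ε)
  have h2 : ‖reconstruct d c‖ ^ 2 ≤ ‖reconstruct d‖ ^ 2 * ∑ ε, ‖c ε‖ ^ 2 := by
    calc ‖reconstruct d c‖ ^ 2 ≤ (‖reconstruct d‖ * ‖c‖) ^ 2 := by
          gcongr
          exact (reconstruct d).le_opNorm c
      _ ≤ _ := by
          rw [mul_pow]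
          gcongr
  have h3 := ENNReal.ofReal_le_ofReal h2
  rw [ENNReal.ofReal_mul (by positivity), ENNReal.ofReal_sum_of_nonneg fun _ _ => sq_nonneg _] at h3
  simpa only [ENNReal.ofReal_pow (norm_nonneg _), ofReal_norm] using h3

/-- The `L²` norm of a function reconstructed from reflected components. -/
theorem lintegral_reconstruct_le {v : Finset (Fin d) → (Fin d → ℝ) → ℂ}
    (hv : ∀ ε, AEStronglyMeasurable (v ε) volume) (r : ℝ) :
    ∫⁻ x, ‖reconstruct d fun ε => r • v ε (flipEquiv ε x)‖ₑ ^ 2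
      ≤ ‖reconstruct d‖ₑ ^ 2 * ∑ ε, ‖r‖ₑ ^ 2 * ∫⁻ x, ‖v ε x‖ₑ ^ 2 := by
  have hm : ∀ ε, AEMeasurable (fun x => ‖r • v ε (flipEquiv ε x)‖ₑ ^ 2) volume := fun ε =>
    (((hv ε).comp_measurePreserving (measurePreserving_flipEquiv ε)).const_smul
      r).enorm.pow_const 2
  refine (lintegral_mono fun x => enorm_reconstruct_sq_le _).trans_eq ?_
  rw [lintegral_const_mul' _ _ (by finiteness), lintegral_finsetSum' _ fun ε _ => hm ε]
  congr 1
  refine Finset.sum_congr rfl fun ε _ => ?_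
  simp only [enorm_smul, mul_pow]
  rw [lintegral_const_mul' _ _ (by finiteness),
    lintegral_comp_flipEquiv ε (fun x => ‖v ε x‖ₑ ^ 2)]

theorem tendsto_lintegral_reconstruct {ι : Type*} {l : Filter ι}
    {u : ι → (Fin d → ℝ) → ScheffersAlgebra d} {v : ι → Finset (Fin d) → (Fin d → ℝ) → ℂ} (r : ℝ)
    (hv : ∀ᶠ i in l, ∀ ε, AEStronglyMeasurable (v i ε) volume)
    (huv : ∀ᶠ i in l, ∀ x, u i x = reconstruct d fun ε => r • v i ε (flipEquiv ε x))
    (hlim : ∀ ε, Tendsto (fun i => ∫⁻ x, ‖v i ε x‖ₑ ^ 2) l (𝓝 0)) :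
    Tendsto (fun i => ∫⁻ x, ‖u i x‖ₑ ^ 2) l (𝓝 0) := by
  have h1 : Tendsto (fun i => ‖reconstruct d‖ₑ ^ 2 * ∑ ε, ‖r‖ₑ ^ 2 * ∫⁻ x, ‖v i ε x‖ₑ ^ 2) l
      (𝓝 0) := by
    have h2 : Tendsto (fun i => ∑ ε : Finset (Fin d), ‖r‖ₑ ^ 2 * ∫⁻ x, ‖v i ε x‖ₑ ^ 2) l
        (𝓝 (∑ _ε : Finset (Fin d), ‖r‖ₑ ^ 2 * 0)) :=
      tendsto_finsetSum _ fun ε _ => ENNReal.Tendsto.const_mul (hlim ε) (Or.inr (by finiteness))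
    have h3 := ENNReal.Tendsto.const_mul (a := ‖reconstruct d‖ₑ ^ 2) h2 (Or.inr (by finiteness))
    simpa using h3
  refine tendsto_of_tendsto_of_tendsto_of_le_of_le' tendsto_const_nhds h1
    (Eventually.of_forall fun _ => zero_le) ?_
  filter_upwards [hv, huv] with i hi1 hi2
  simp only [hi2]
  exact lintegral_reconstruct_le hi1 r

/-- Uniqueness of `L²` limits by the triangle inequality; `f` and `g` need not be assumed square
integrable. -/
theorem ae_eq_of_tendsto_lintegral {α ι E : Type*} [MeasurableSpace α] {μ : Measure α}
    [NormedAddCommGroup E] {l : Filter ι} [l.NeBot] {u : ι → α → E} {f g : α → E}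
    (hu : ∀ i, AEStronglyMeasurable (u i) μ) (hf : AEStronglyMeasurable f μ)
    (hg : AEStronglyMeasurable g μ)
    (huf : Tendsto (fun i => ∫⁻ x, ‖u i x - f x‖ₑ ^ 2 ∂μ) l (𝓝 0))
    (hug : Tendsto (fun i => ∫⁻ x, ‖u i x - g x‖ₑ ^ 2 ∂μ) l (𝓝 0)) : f =ᵐ[μ] g := by
  have hroot : ∀ {w : ι → α → E}, Tendsto (fun i => ∫⁻ x, ‖w i x‖ₑ ^ 2 ∂μ) l (𝓝 0) →
      Tendsto (fun i => eLpNorm (w i) 2 μ) l (𝓝 0) := by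
    intro w hw
    have h1 := (ENNReal.continuous_rpow_const (y := ((2 : ℕ) : ℝ)⁻¹)).tendsto 0 |>.comp hw
    rw [ENNReal.zero_rpow_of_pos (by norm_num)] at h1
    refine h1.congr fun i => ?_
    rw [Function.comp_apply, ← eLpNorm_two_sq, ENNReal.pow_rpow_inv_natCast two_ne_zero]
  have h1 := (hroot hug).add (hroot huf)
  rw [add_zero] at h1
  have h2 : eLpNorm (f - g) 2 μ ≤ 0 := by
    refine ge_of_tendsto h1 (Eventually.of_forall fun i => ?_)
    have e : f - g = (u i - g) - (u i - f) := by abel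
    rw [e]
    exact eLpNorm_sub_le ((hu i).sub hg) ((hu i).sub hf) (by norm_num)
  have h3 := (eLpNorm_eq_zero_iff (hf.sub hg) two_ne_zero).1 (le_antisymm h2 zero_le)
  filter_upwards [h3] with x hx
  exact sub_eq_zero.1 hx

/-! ### The two halves of the theorem in the Scheffers algebra -/

theorem MemL2Plus.orthantL2 {g : (Fin d → ℝ) → ScheffersAlgebra d} (hg : MemL2Plus g)
    (ε : Finset (Fin d)) : OrthantL2 fun ω => character ε (g ω) :=
  ⟨memLp_iff_character.1 hg.1 ε, hg.2.mono fun ω hω hm => by simp only [hω hm, map_zero]⟩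

theorem MemL2Plus.integrable {g : (Fin d → ℝ) → ScheffersAlgebra d} (hg : MemL2Plus g)
    {ζ : TotalSpace d} (hζ : ζ ∈ upperSpace d) : Integrable fun ω => g ω * fourierKernel ω ζ :=
  integrable_mul_fourierKernel_iff.2 fun ε =>
    (hg.orthantL2 ε).integrable_mul_expKernel (complexCoord_mem hζ ε)

theorem MemL2Plus.inverseFourier_point {g : (Fin d → ℝ) → ScheffersAlgebra d} (hg : MemL2Plus g)
    {y : Fin d → ℝ} (hy : ∀ k, 0 < y k) (x : Fin d → ℝ) :
    inverseFourier g (point x y) = reconstruct d fun ε => (((2 * Real.pi) ^ d)⁻¹ : ℝ) •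
      fourierLaplace (fun ω => character ε (g ω)) (complexPoint (flipEquiv ε x) y) := by
  rw [← reconstruct_character (inverseFourier g (point x y))]
  simp only [character_inverseFourier (hg.integrable (point_mem_upperSpace hy x)),
    complexCoord_point_eq]

theorem OrthantL2.continuous_fourierLaplace {h : (Fin d → ℝ) → ℂ} (hh : OrthantL2 h)
    {y : Fin d → ℝ} (hy : ∀ k, 0 < y k) :
    Continuous fun x => fourierLaplace h (complexPoint x y) := by
  simp only [fourierLaplace_complexPoint]
  exact continuous_fourierLaplace_realPoint (hh.integrable_damp hy)

theorem MemL2Plus.memHardy {g : (Fin d → ℝ) → ScheffersAlgebra d} (hg : MemL2Plus g) :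
    MemHardy (inverseFourier g) := by
  refine ⟨holomorphicOn_of_character (F := fun ε z => (((2 * Real.pi) ^ d)⁻¹ : ℝ) •
    fourierLaplace (fun ω => character ε (g ω)) z) (fun ε z hz k => ?_) fun ε ζ hζ =>
      character_inverseFourier (hg.integrable hζ) ε, ?_⟩
  · exact ((hg.orthantL2 ε).differentiableAt_fourierLaplace hz k).const_smul
      (((2 * Real.pi) ^ d)⁻¹ : ℝ)
  · refine lt_of_le_of_lt (iSup₂_le fun y hy => ?_)
      (b := ‖reconstruct d‖ₑ ^ 2 * ∑ ε : Finset (Fin d), ‖(((2 * Real.pi) ^ d)⁻¹ : ℝ)‖ₑ ^ 2 *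
        (ENNReal.ofReal ((2 * Real.pi) ^ d) * ∫⁻ ω, ‖character ε (g ω)‖ₑ ^ 2)) ?_
    · simp only [hg.inverseFourier_point hy]
      refine (lintegral_reconstruct_le (v := fun ε x =>
        fourierLaplace (fun ω => character ε (g ω)) (complexPoint x y))
        (fun ε => ((hg.orthantL2 ε).continuous_fourierLaplace hy).aestronglyMeasurable) _).trans ?_
      gcongr with ε
      exact (hg.orthantL2 ε).lintegral_fourierLaplace_le hy
    · refine ENNReal.mul_lt_top (by finiteness) (ENNReal.sum_lt_top.2 fun ε _ => ?_)
      exact ENNReal.mul_lt_top (by finiteness) (ENNReal.mul_lt_top ENNReal.ofReal_lt_top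
        (hg.orthantL2 ε).1.lintegral_sq_lt_top)

theorem inverseFourier_truncation {g : (Fin d → ℝ) → ScheffersAlgebra d} (hg : MemLp g 2 volume)
    (R : ℝ) (x : Fin d → ℝ) :
    inverseFourier ((Set.Icc (fun _ => -R) (fun _ => R)).indicator g) (point x 0)
      = reconstruct d fun ε => (((2 * Real.pi) ^ d)⁻¹ : ℝ) • fourierLaplace
        ((Set.Icc (fun _ => -R) (fun _ => R)).indicator fun ω => character ε (g ω))
          (realPoint (flipEquiv ε x)) := by
  set S : Set (Fin d → ℝ) := Set.Icc (fun _ => -R) (fun _ => R)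
  have hchar : ∀ ε, (fun ω => character ε (S.indicator g ω))
      = S.indicator fun ω => character ε (g ω) := by
    intro ε
    ext ω
    by_cases hω : ω ∈ S <;> simp [hω]
  have hint : Integrable fun ω => S.indicator g ω * fourierKernel ω (point x 0) := by
    refine integrable_mul_fourierKernel_iff.2 fun ε => ?_
    have h1 := integrable_indicator_Icc (memLp_iff_character.1 hg ε) (fun _ => -R) (fun _ => R)
    rw [← hchar ε] at h1
    refine h1.mul_bdd (c := 1) (continuous_expKernel _).aestronglyMeasurable
      (Eventually.of_forall fun ω => ?_)
    rw [norm_expKernel, complexCoord_point_eq]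
    simp [im_complexPoint]
  rw [← reconstruct_character (inverseFourier _ (point x 0))]
  simp only [character_inverseFourier hint, complexCoord_point_eq, complexPoint_zero, hchar]

theorem continuous_inverseFourier_truncation {g : (Fin d → ℝ) → ScheffersAlgebra d}
    (hg : MemLp g 2 volume) (R : ℝ) : Continuous fun x =>
      inverseFourier ((Set.Icc (fun _ => -R) (fun _ => R)).indicator g) (point x 0) := by
  simp only [inverseFourier_truncation hg]
  refine (reconstruct d).continuous.comp (continuous_pi fun ε => ?_)
  exact ((continuous_fourierLaplace_realPoint (integrable_indicator_Icc
    (memLp_iff_character.1 hg ε) _ _)).comp (continuous_flipEquiv ε)).const_smul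
      (((2 * Real.pi) ^ d)⁻¹ : ℝ)

/-- The inverse Fourier transform of a function in `L²` of the orthant exists and is the boundary
value of the holomorphic inverse Fourier transform. -/
theorem MemL2Plus.exists_boundaryValue {g : (Fin d → ℝ) → ScheffersAlgebra d} (hg : MemL2Plus g) :
    ∃ f₀, IsInverseFourierL2 g f₀ ∧ Tendsto (fun y : Fin d → ℝ =>
      ∫⁻ x : Fin d → ℝ, ‖inverseFourier g (point x y) - f₀ x‖ₑ ^ 2)
        (𝓝[{y | ∀ k, 0 < y k}] 0) (𝓝 0) := by
  -- The same Plancherel transform of each component is the limit both of the cube truncations and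
  -- of the slices as `y → 0`, so the two limits agree by construction.
  choose F hF hFh using fun ε => exists_plancherel (hg.orthantL2 ε).1
  have hsub : ∀ a b : Finset (Fin d) → ℂ,
      (reconstruct d fun ε => (((2 * Real.pi) ^ d)⁻¹ : ℝ) • a ε)
        - (reconstruct d fun ε => (((2 * Real.pi) ^ d)⁻¹ : ℝ) • b ε)
      = reconstruct d fun ε => (((2 * Real.pi) ^ d)⁻¹ : ℝ) • (a ε - b ε) := by
    intro a b
    rw [← map_sub]
    congr 1
    ext ε
    rw [Pi.sub_apply, smul_sub]
  refine ⟨fun x => reconstruct d fun ε => (((2 * Real.pi) ^ d)⁻¹ : ℝ) • F ε (flipEquiv ε x),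
    ⟨?_, ?_⟩, ?_⟩
  · exact (reconstruct d).comp_memLp' (MemLp.of_eval fun ε =>
      ((hF ε).comp_measurePreserving (measurePreserving_flipEquiv ε)).const_smul
        (((2 * Real.pi) ^ d)⁻¹ : ℝ))
  · refine tendsto_lintegral_reconstruct (v := fun R ε x => fourierLaplace
      ((Set.Icc (fun _ => -R) (fun _ => R)).indicator fun ω => character ε (g ω))
        (realPoint x) - F ε x) (((2 * Real.pi) ^ d)⁻¹) (Eventually.of_forall fun R ε => ?_)
      (Eventually.of_forall fun R x => ?_) fun ε =>
        tendsto_lintegral_truncation (hg.orthantL2 ε).1 (hFh ε)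
    · exact (continuous_fourierLaplace_realPoint (integrable_indicator_Icc
        (hg.orthantL2 ε).1 _ _)).aestronglyMeasurable.sub (hF ε).1
    · rw [inverseFourier_truncation hg.1, hsub]
  · refine tendsto_lintegral_reconstruct (v := fun y ε x => fourierLaplace
      (fun ω => character ε (g ω)) (complexPoint x y) - F ε x) (((2 * Real.pi) ^ d)⁻¹) ?_ ?_
      fun ε => (hg.orthantL2 ε).tendsto_lintegral_fourierLaplace (hFh ε)
    · filter_upwards [self_mem_nhdsWithin] with y hy ε
      exact ((hg.orthantL2 ε).continuous_fourierLaplace hy).aestronglyMeasurable.sub (hF ε).1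
    · filter_upwards [self_mem_nhdsWithin] with y hy x
      rw [hg.inverseFourier_point hy, hsub]

theorem IsInverseFourierL2.ae_eq {g f₀ f₁ : (Fin d → ℝ) → ScheffersAlgebra d}
    (hg : MemLp g 2 volume) (h₀ : IsInverseFourierL2 g f₀) (h₁ : IsInverseFourierL2 g f₁) :
    f₀ =ᵐ[volume] f₁ :=
  ae_eq_of_tendsto_lintegral
    (fun R => (continuous_inverseFourier_truncation hg R).aestronglyMeasurable)
    h₀.1.1 h₁.1.1 h₀.2 h₁.2

/-- Characters are bounded linear maps, and the passage to complex coordinates only reflects `x`. -/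
theorem MemHardy.exists_lintegral_le {f : TotalSpace d → ScheffersAlgebra d} (hf : MemHardy f)
    (ε : Finset (Fin d)) : ∃ C : ℝ≥0∞, C ≠ ∞ ∧ ∀ y : Fin d → ℝ, (∀ k, 0 < y k) →
      ∫⁻ x, ‖character ε (f (coordPoint ε (complexPoint x y)))‖ₑ ^ 2 ≤ C := by
  refine ⟨‖characterL (d := d) ε‖ₑ ^ 2 *
    (⨆ (y : Fin d → ℝ) (_ : ∀ k, 0 < y k), ∫⁻ x : Fin d → ℝ, ‖f (point x y)‖ₑ ^ 2),
    ENNReal.mul_ne_top (by finiteness) hf.2.ne, fun y hy => ?_⟩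
  have e : ∀ x, coordPoint ε (complexPoint x y) = point (flipEquiv ε x) y := by
    intro x
    ext k : 1
    simp [coordPoint, point, re_complexPoint, im_complexPoint, flipEquiv_apply]
  simp only [e]
  rw [lintegral_comp_flipEquiv ε fun x => ‖character ε (f (point x y))‖ₑ ^ 2]
  calc ∫⁻ x, ‖character ε (f (point x y))‖ₑ ^ 2
      ≤ ∫⁻ x, ‖characterL (d := d) ε‖ₑ ^ 2 * ‖f (point x y)‖ₑ ^ 2 := by
        refine lintegral_mono fun x => ?_
        simp only [← mul_pow]
        gcongr
        exact (characterL ε).le_opENorm _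
    _ = ‖characterL (d := d) ε‖ₑ ^ 2 * ∫⁻ x, ‖f (point x y)‖ₑ ^ 2 :=
        lintegral_const_mul' _ _ (by finiteness)
    _ ≤ _ := by
        gcongr
        exact le_iSup₂ (f := fun (y : Fin d → ℝ) (_ : ∀ k, 0 < y k) =>
          ∫⁻ x : Fin d → ℝ, ‖f (point x y)‖ₑ ^ 2) y hy

/-- The densities `g ε` are chosen independently for each character and need not be the characters
of one function. Linearity of `reconstruct` over `𝕊_d` lets it pass through the kernel and the
integral, where it meets the genuine characters of `f ζ`. -/
theorem MemHardy.exists_memL2Plus {f : TotalSpace d → ScheffersAlgebra d} (hf : MemHardy f) :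
    ∃ g : (Fin d → ℝ) → ScheffersAlgebra d, MemL2Plus g ∧
      ∀ ζ ∈ upperSpace d, f ζ = inverseFourier g ζ := by
  have hex : ∀ ε, ∃ g : (Fin d → ℝ) → ℂ, OrthantL2 g ∧ ∀ z ∈ upperPolyplane d,
      fourierLaplace g z = ((2 * Real.pi) ^ d : ℝ) • character ε (f (coordPoint ε z)) := by
    intro ε
    obtain ⟨C, hC, hfC⟩ := hf.exists_lintegral_le ε
    exact (hf.1.separatelyHolomorphic ε).exists_orthantL2 hC hfC
  choose g hgO hgf using hex
  refine ⟨fun ω => reconstruct d fun ε => g ε ω,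
    ⟨(reconstruct d).comp_memLp' (MemLp.of_eval fun ε => (hgO ε).1), ?_⟩, fun ζ hζ => ?_⟩
  · filter_upwards [ae_all_iff.2 fun ε => (hgO ε).2] with ω hω hm
    rw [show (fun ε => g ε ω) = 0 from funext fun ε => hω ε hm, map_zero]
  · have hmul : ∀ ω, (reconstruct d fun ε => g ε ω) * fourierKernel ω ζ
        = reconstruct d fun ε => g ε ω * expKernel ω (complexCoord ε ζ) := by
      intro ω
      rw [mul_comm, ← reconstruct_character_mul]
      simp only [character_fourierKernel, mul_comm]
    have hint : ∀ ε, Integrable fun ω => g ε ω * expKernel ω (complexCoord ε ζ) := fun ε =>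
      (hgO ε).integrable_mul_expKernel (complexCoord_mem hζ ε)
    have hval : ∫ ω, (fun ε => g ε ω * expKernel ω (complexCoord ε ζ))
        = ((2 * Real.pi) ^ d : ℝ) • fun ε => character ε (f ζ) := by
      ext ε
      rw [eval_integral hint, Pi.smul_apply]
      exact (hgf ε _ (complexCoord_mem hζ ε)).trans (by rw [coordPoint_complexCoord])
    rw [inverseFourier]
    simp only [hmul]
    rw [(reconstruct d).integral_comp_comm (Integrable.of_eval hint), hval, map_smul,
      reconstruct_character, smul_smul, inv_mul_cancel₀ (by positivity), one_smul]

end ScheffersAlgebra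

end

open ScheffersAlgebra in
theorem mainTheorem2 (d : ℕ) :
    (∀ fhat : (Fin d → ℝ) → ScheffersAlgebra d, MemL2Plus fhat →
      (∀ ζ ∈ upperSpace d, Integrable (fun ω : Fin d → ℝ => fhat ω * fourierKernel ω ζ)) ∧
      MemHardy (inverseFourier fhat) ∧
      (∃ f₀ : (Fin d → ℝ) → ScheffersAlgebra d, IsInverseFourierL2 fhat f₀) ∧
      (∀ f₀ : (Fin d → ℝ) → ScheffersAlgebra d, IsInverseFourierL2 fhat f₀ →
        Tendsto (fun y : Fin d → ℝ =>
            ∫⁻ x : Fin d → ℝ, ‖inverseFourier fhat (point x y) - f₀ x‖ₑ ^ 2)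
          (𝓝[{y | ∀ k, 0 < y k}] 0) (𝓝 0))) ∧
    (∀ f : TotalSpace d → ScheffersAlgebra d, MemHardy f →
      ∃ g : (Fin d → ℝ) → ScheffersAlgebra d, MemL2Plus g ∧
        (∀ ζ ∈ upperSpace d, Integrable (fun ω : Fin d → ℝ => g ω * fourierKernel ω ζ)) ∧
        ∀ ζ ∈ upperSpace d, f ζ = inverseFourier g ζ) := by
  refine ⟨fun fhat hf => ?_, fun f hf => ?_⟩
  · obtain ⟨f₁, hf₁, hlim⟩ := hf.exists_boundaryValue
    refine ⟨fun ζ hζ => hf.integrable hζ, hf.memHardy, ⟨f₁, hf₁⟩, fun f₀ hf₀ => ?_⟩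
    -- The limit is known for one inverse transform `f₁`; any other `f₀` agrees with it almost
    -- everywhere.
    refine hlim.congr fun y => lintegral_congr_ae ?_
    filter_upwards [IsInverseFourierL2.ae_eq hf.1 hf₁ hf₀] with x hx
    rw [hx]
  · obtain ⟨g, hg, hfg⟩ := hf.exists_memL2Plus
    exact ⟨g, hg, fun ζ hζ => hg.integrable hζ, hfg⟩
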